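/- **Notation.** Let $P$ be a finite set of points of a metric space, let $k\ge 1$ and $z\ge 0$ be integers with $k<|P|$, and let $D$ be the doubling dimension of $P$, i.e. the smallest $D$ such that for all $p\in P$, $r>0$ the points of $P$ at distance at most $r$ from $p$ are covered by at most $2^D$ balls of radius $r/2$ centered at points of $P$. For $S\ne\emptyset$ put $\mathrm{cost}(Q,S)=\sum_{p\in Q}d(p,S)^2$; let $\mathrm{out}_m(P,S)$ be a set of $m$ points of $P$ farthest from $S$ (ties broken arbitrarily; all of $P$ if $m\ge|P|$). Let $\mathrm{OPT}_k(Q)$ be the minimum of $\mathrm{cost}(Q,S)$, and $\mathrm{OPT}_{k,z}(P)$ the minimum of $\mathrm{cost}(P\setminus\mathrm{out}_z(P,S),S)$, over sets $S$ of $k$ centers from $Q$, resp. $P$ (nonempty sets of at most $k$ centers, if the point set has fewer than $k$ points). For positive integer weights $\mathbf w$ on $T$, let $\mathrm{cost}(T,\mathbf w,S)=\sum_{q\in T}w_q\,d(q,S)^2$, and let $\mathrm{OPT}_{k,z}(T,\mathbf w)$ be the minimum over $S\subseteq T$ of $\mathrm{cost}(T,\hat{\mathbf w},S)$, where $\hat{\mathbf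 w}$ is obtained from $\mathbf w$ by subtracting $z$ units of weight progressively from the points of $T$ farthest from $S$. Let $0<\gamma\le\sqrt{3/8}-1/2$, $\beta,\rho,\tau\ge 1$, $\alpha\ge 0$; where integers are needed, $\rho k$ and $\tau z$ are rounded down. **Procedures.** Let SeqkMeans be a sequential algorithm that, for each nonempty $Q\subseteq P$ and $k'=\rho k+\tau z$, returns a set $S\subseteq Q$ of at most $k'$ centers with $\mathrm{cost}(Q,S)\le\beta\,\mathrm{OPT}_{k'}(Q)$. Let SeqWeightedkMeansOut be a sequential algorithm that, for each weighted set $(T,\mathbf w)$ with $T\subseteq P$ and total weight $|P|$, returns a nonempty set $S\subseteq T$ of at most $\rho k$ centers with $\mathrm{cost}(T,\hat{\mathbf w},S)\le\alpha\,\mathrm{OPT}_{k,z}(T,\mathbf w)$, where $\hat{\mathbf w}$ arises from $\mathbf w$ by subtracting $\tau z$ units of weight from the points of $T$ farthest from $S$. Both use at most $A$ words of work space per input point. CoverWithBalls$(Q,X,\delta,R)$ repeatedly selects an arbitrary remaining $q\in Q$ and removes all remaining $p$ with $d(p,q)\le\delta\max\{R,d(p,X)\}$; it returns the selected points, each weighted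 by the number of points it removed (itself included). **Algorithm.** The 3-round MapReduce algorithm works on an arbitrary partition of $P$ into $L$ parts $P_1,\dots,P_L$, $1\le L\le|P|$, whose sizes differ by at most one. Round 1: for each $i$, a reducer computes $S_i=$ SeqkMeans$(P_i,\rho k+\tau z)$, $R_i=\sqrt{\mathrm{cost}(P_i,S_i)/|P_i|}$, and the point set $C_i$ returned by CoverWithBalls$(P_i,S_i,\gamma/\sqrt{2\beta},R_i)$. Round 2: for each $i$, a reducer that receives $P_i$ and all triplets $(|P_j|,R_j,C_j)$ computes $T_i=$ CoverWithBalls$(P_i,\bigcup_jC_j,\gamma/\sqrt{2\beta},R)$ with $R=\sqrt{\sum_j|P_j|R_j^2/|P|}$. Round 3: one reducer gathers the weighted set $T=\bigcup_iT_i$ and outputs $S=$ SeqWeightedkMeansOut$(T,\mathbf w^T,k,z)$. **Theorem.** The algorithm outputs a nonempty set $S\subseteq P$ of at most $\rho k$ centers such that \[\mathrm{cost}(P\setminus\mathrm{out}_{\tau z}(P,S),S)\le(\alpha+c\,\alpha\gamma)\cdot\mathrm{OPT}_{k,z}(P),\] where $c$ is a universal constant. With $L=\lceil(|P|/(\rho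 k+\tau z))^{1/3}\rceil$, its local memory (the maximum, over all executions of a map or reduce function, of the number of words of input, output and work space, a point or a number taking one word) is at most \[c\,(1+A)\cdot|P|^{2/3}(\rho k+\tau z)^{1/3}\,(8\sqrt{2\beta}/\gamma)^{2D}\,\log^2|P| .\] -/

import Mathlib

open scoped Classical

noncomputable section

namespace KMeansOutliers

/-! ### k-means with outliers -/

section Clustering

variable {M : Type*} [MetricSpace M]

/-- `cost(P, S) = ∑_{p ∈ P} d(p, S)²`; here `d(p, S)` is `Metric.infDist`, which is the minimum
of the distances from `p` to the points of `S` when `S` is finite and nonempty. -/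
def cost (P S : Finset M) : ℝ :=
  ∑ p ∈ P, Metric.infDist p (S : Set M) ^ 2

/-- `S` is a feasible set of centers for the point set `P` and the parameter `k`: a nonempty
subset of `P` with at most `k` points. (Additional centers never increase a cost, so that for
`k ≤ |P|` the optima below do not change if exactly `k` centers are required; the form with
`≤` also covers subsets of a dataset that have fewer than `k` points.) -/
def IsSolution (k : ℕ) (P S : Finset M) : Prop :=
  S ⊆ P ∧ S.Nonempty ∧ S.card ≤ k

/-- `Z` is a set `out_z(P, S)`: `z` points of `P` farthest from `S`, ties broken arbitrarily
(all of `P` if `z ≥ |P|`). -/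
def IsOut (z : ℕ) (P S Z : Finset M) : Prop :=
  Z ⊆ P ∧ Z.card = min z P.card ∧
    ∀ p ∈ Z, ∀ q ∈ P \ Z,
      Metric.infDist q (S : Set M) ≤ Metric.infDist p (S : Set M)

/-- `OPT_k(P)`. -/
def opt (k : ℕ) (P : Finset M) : ℝ :=
  sInf {c | ∃ S, IsSolution k P S ∧ c = cost P S}

/-- `OPT_{k,z}(P)`. -/
def optOut (k z : ℕ) (P : Finset M) : ℝ :=
  sInf {c | ∃ S Z, IsSolution k P S ∧ IsOut z P S Z ∧ c = cost (P \ Z) S}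

/-- `cost(T, w, S)`. A weighted set `(T, w)` with positive integer weights is a finitely
supported function `w : M →₀ ℕ`, with `T = w.support`. -/
def wcost (w : M →₀ ℕ) (S : Finset M) : ℝ :=
  ∑ p ∈ w.support, (w p : ℝ) * Metric.infDist p (S : Set M) ^ 2

/-- The total weight of a weighted set. -/
def weight (w : M →₀ ℕ) : ℕ := ∑ p ∈ w.support, w p

/-- `v` is a weight function `ŵ` obtained from `w` by subtracting exactly `z` units of weight
(everything, if the total weight is less than `z`) from the points farthest from `S`,
progressively and with ties broken arbitrarily: no point that keeps some weight is farther from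
`S` than a point that loses some. -/
def IsTrimmed (z : ℕ) (w : M →₀ ℕ) (S : Finset M) (v : M →₀ ℕ) : Prop :=
  (∀ p, v p ≤ w p) ∧ weight v = weight w - z ∧
    ∀ p q, v p < w p → 0 < v q →
      Metric.infDist q (S : Set M) ≤ Metric.infDist p (S : Set M)

/-- `OPT_{k,z}(T, w)`. -/
def woptOut (k z : ℕ) (w : M →₀ ℕ) : ℝ :=
  sInf {c | ∃ S v, IsSolution k w.support S ∧ IsTrimmed z w S v ∧ c = wcost v S}

/-- The doubling dimension of `P`: the smallest `D` such that, for all `p ∈ P` and `r > 0`, the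
points of `P` at distance at most `r` from `p` are covered by at most `2 ^ D` balls of radius
`r / 2` centered at points of `P`. -/
def doublingDim (P : Finset M) : ℝ :=
  sInf {D : ℝ | ∀ p ∈ P, ∀ r : ℝ, 0 < r → ∃ Q ⊆ P, (Q.card : ℝ) ≤ (2 : ℝ) ^ D ∧
    ∀ x ∈ P, dist x p ≤ r → ∃ q ∈ Q, dist x q ≤ r / 2}

end Clustering

/-! ### The MapReduce model -/

/-- The result of a computation together with the number of memory words of its work space. -/
structure Metered (β : Type*) where
  val : β
  work : ℕ

/-- A round of a MapReduce algorithm on key-value pairs with keys in `ℕ` and values in `V`. -/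
structure Round (V : Type*) where
  map : ℕ × V → Metered (Multiset (ℕ × V))
  reduce : ℕ → Multiset V → Metered (Multiset (ℕ × V))

section MapReduce

variable {V : Type*}

/-- The number of words of a multiset of pairs: one word for each key plus the values. -/
def pairWords (size : V → ℕ) (x : Multiset (ℕ × V)) : ℕ :=
  (x.map fun a => 1 + size a.2).sum

/-- The pairs produced by the map function, applied to each individual pair. -/
def Round.mapped (r : Round V) (x : Multiset (ℕ × V)) : Multiset (ℕ × V) :=
  x.bind fun a => (r.map a).val

/-- The keys that occur in `x`. -/
def keys (x : Multiset (ℕ × V)) : Finset ℕ := (x.map Prod.fst).toFinset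

/-- The values of the pairs of `x` with key `i`. -/
def group (x : Multiset (ℕ × V)) (i : ℕ) : Multiset V :=
  (x.filter fun a => a.1 = i).map Prod.snd

/-- The output of a round: the reduce function is applied, for each key that occurs among the
mapped pairs, to the values with that key. -/
def Round.exec (r : Round V) (x : Multiset (ℕ × V)) : Multiset (ℕ × V) :=
  (keys (r.mapped x)).val.bind fun i => (r.reduce i (group (r.mapped x) i)).val

/-- The local memory of one execution of the map function: input, output and work space. -/
def Round.mapMemory (size : V → ℕ) (r : Round V) (a : ℕ × V) : ℕ :=
  pairWords size {a} + pairWords size (r.map a).val + (r.map a).work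

/-- The local memory of one execution of the reduce function: input, output and work space. -/
def Round.reduceMemory (size : V → ℕ) (r : Round V) (i : ℕ) (v : Multiset V) : ℕ :=
  pairWords size (v.map fun b => (i, b)) + pairWords size (r.reduce i v).val + (r.reduce i v).work

/-- The maximum local memory of an execution of the map or of the reduce function in a round. -/
def Round.memory (size : V → ℕ) (r : Round V) (x : Multiset (ℕ × V)) : ℕ :=
  max (x.map fun a => r.mapMemory size a).sup
    ((keys (r.mapped x)).sup fun i => r.reduceMemory size i (group (r.mapped x) i))

/-- A MapReduce algorithm is the sequence of its rounds; `run` is its output on the input `x`. -/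
def run : List (Round V) → Multiset (ℕ × V) → Multiset (ℕ × V)
  | [], x => x
  | r :: rs, x => run rs (r.exec x)

/-- The local memory of a MapReduce algorithm on the input `x`: the maximum over all rounds. -/
def localMemory (size : V → ℕ) : List (Round V) → Multiset (ℕ × V) → ℕ
  | [], _ => 0
  | r :: rs, x => max (r.memory size x) (localMemory size rs (r.exec x))

end MapReduce

/-! ### The sequential procedures -/

section Sequential

variable {M : Type*} [MetricSpace M]

/-- A rule for the arbitrary selection of a point from the current set of points. -/
def Selector (M : Type*) : Type _ := ∀ s : Finset M, s.Nonempty → {q : M // q ∈ s}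

/-- `CoverWithBalls(P, X, δ, R)`: as long as `P` is nonempty, select a point `q` of `P`, remove
from `P` the points `p` (including `q`) with `d(p, q) ≤ δ max {R, d(p, X)}`, whose proxy is now
`q`, and give `q` the number of removed points as its weight. The work space holds `X`, the
current set `P`, two words (point and weight) for each point selected so far, and eight words for
local variables. -/
def coverWithBalls (sel : Selector M) (X : Finset M) (δ R : ℝ) (P : Finset M) :
    Metered (M →₀ ℕ) :=
  if h : P.Nonempty then
    let q := (sel P h).1
    let B := P.filter fun p => p = q ∨ dist p q ≤ δ * max R (Metric.infDist p (X : Set M))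
    let rest := coverWithBalls sel X δ R (P \ B)
    { val := Finsupp.single q B.card + rest.val
      work := max (X.card + P.card + 8) (rest.work + 2) }
  else
    { val := 0
      work := X.card + 8 }
termination_by P.card
decreasing_by
  refine Finset.card_lt_card (Finset.sdiff_ssubset (Finset.filter_subset _ _) ⟨q, ?_⟩)
  exact Finset.mem_filter.2 ⟨(sel P h).2, Or.inl rfl⟩

/-- A sequential algorithm for k-means: on a point set and a number of centers it returns a set
of centers, using the given number of words of work space. -/
abbrev SeqKMeans (M : Type*) : Type _ := Finset M → ℕ → Metered (Finset M)

/-- A sequential algorithm for weighted k-means with outliers: on a weighted set, a number `k` of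
centers and a number `z` of outliers it returns a set of centers, using the given number of words
of work space. -/
abbrev SeqWeightedKMeansOut (M : Type*) : Type _ := (M →₀ ℕ) → ℕ → ℕ → Metered (Finset M)

/-- On the nonempty subsets of `P`, with `k` centers, `seqK` is a `β`-approximation algorithm
for k-means, with work space at most `A` words per input point. -/
def SeqKMeans.IsApprox (seqK : SeqKMeans M) (P : Finset M) (k A : ℕ) (β : ℝ) : Prop :=
  ∀ Q ⊆ P, Q.Nonempty →
    IsSolution k Q (seqK Q k).val ∧
    cost Q (seqK Q k).val ≤ β * opt k Q ∧
    (seqK Q k).work ≤ A * Q.card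

/-- On the weighted sets of points of `P` with total weight `|P|`, for the parameters `k` and
`z`, `seqW` is a bicriteria `α`-approximation algorithm for weighted k-means with outliers, which
may use `ρ k` centers and exclude `τ z` units of weight, with work space at most `A` words per
input point. -/
def SeqWeightedKMeansOut.IsApprox (seqW : SeqWeightedKMeansOut M) (P : Finset M) (k z A : ℕ)
    (ρ τ α : ℝ) : Prop :=
  ∀ w : M →₀ ℕ, w.support ⊆ P → weight w = P.card →
    IsSolution ⌊ρ * k⌋₊ w.support (seqW w k z).val ∧
    (∃ v, IsTrimmed ⌊τ * z⌋₊ w (seqW w k z).val v ∧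
      wcost v (seqW w k z).val ≤ α * woptOut k z w) ∧
    (seqW w k z).work ≤ A * w.support.card

end Sequential

/-! ### The 3-round algorithm -/

/-- The values of the key-value pairs of the algorithm. -/
inductive Value (M : Type*) where
  /-- An input point. -/
  | point (p : M)
  /-- A triplet `(|P_j|, R_j, C_j)`. -/
  | triplet (n : ℕ) (R : ℝ) (C : Finset M)
  /-- A coreset point with its weight. -/
  | weighted (q : M) (w : ℕ)
  /-- A center of the solution. -/
  | center (s : M)

section Algorithm

variable {M : Type*} [MetricSpace M]

/-- The number of words of a value: points and numbers take one word each. -/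
def Value.words : Value M → ℕ
  | .point _ => 1
  | .triplet _ _ C => 2 + C.card
  | .weighted _ _ => 2
  | .center _ => 1

def Value.getPoint : Value M → Option M
  | .point p => some p
  | _ => none

def Value.getTriplet : Value M → Option (ℕ × ℝ × Finset M)
  | .triplet n R C => some (n, R, C)
  | _ => none

def Value.getWeighted : Value M → Option (M × ℕ)
  | .weighted q w => some (q, w)
  | _ => none

def Value.getCenter : Value M → Option M
  | .center s => some s
  | _ => none

/-- The points in a multiset of values. -/
def points (v : Multiset (Value M)) : Finset M := (v.filterMap Value.getPoint).toFinset

/-- The triplets in a multiset of values. -/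
def triplets (v : Multiset (Value M)) : Multiset (ℕ × ℝ × Finset M) :=
  v.filterMap Value.getTriplet

/-- The weighted set that consists of the weighted points in a multiset of values. -/
def weightedSet (v : Multiset (Value M)) : M →₀ ℕ :=
  ((v.filterMap Value.getWeighted).map fun a => Finsupp.single a.1 a.2).sum

/-- The centers in a multiset of values. -/
def centers (v : Multiset (Value M)) : Finset M := (v.filterMap Value.getCenter).toFinset

/-- `part` assigns the points of `P` to `L` parts with the indices `0, …, L - 1`, evenly: the
sizes of any two parts differ by at most one. -/
def IsEvenPartition (P : Finset M) (L : ℕ) (part : M → ℕ) : Prop :=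
  (∀ p ∈ P, part p < L) ∧
    ∀ i < L, ∀ j < L,
      (P.filter fun p => part p = i).card ≤ (P.filter fun p => part p = j).card + 1

/-- Round 1 of `MRcoreset(P, k, z, γ)`. The map function sends each point to the reducer of its
part. The reducer in charge of `P_i` computes `S_i` with `seqK` and `k' = k + z`, then `R_i` and
the support `C_i` of the output of `CoverWithBalls(P_i, S_i, γ / √(2β), R_i)`; it emits the
points of `P_i` again, for use in the next round, and the triplet `(|P_i|, R_i, C_i)`. -/
def coresetRound1 (seqK : SeqKMeans M) (sel : Selector M) (part : M → ℕ) (k z : ℕ) (β γ : ℝ) :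
    Round (Value M) where
  map
    | (_, .point p) => { val := {(part p, .point p)}, work := 1 }
    | _ => { val := 0, work := 1 }
  reduce i v :=
    let Pi := points v
    let S := seqK Pi (k + z)
    let R := √(cost Pi S.val / Pi.card)
    let C := coverWithBalls sel S.val (γ / √(2 * β)) R Pi
    { val := (Pi.val.map fun p => (i, .point p)) + {(i, .triplet Pi.card R C.val.support)}
      work := S.work + S.val.card + C.work + 8 }

/-- Round 2 of `MRcoreset(P, k, z, γ)`. The map function sends each point to the reducer of its
part again, and each triplet to all `L` reducers. The reducer in charge of `P_i` computes
`R = √(∑_j |P_j| R_j² / |P|)` and `C = ⋃_j C_j`, and emits the weighted set returned by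
`CoverWithBalls(P_i, C, γ / √(2β), R)`. -/
def coresetRound2 (sel : Selector M) (part : M → ℕ) (L : ℕ) (β γ : ℝ) :
    Round (Value M) where
  map
    | (_, .point p) => { val := {(part p, .point p)}, work := 1 }
    | (_, .triplet n R C) =>
        { val := (Multiset.range L).map fun i => (i, .triplet n R C), work := 1 }
    | _ => { val := 0, work := 1 }
  reduce i v :=
    let Pi := points v
    let n : ℕ := ((triplets v).map fun t => t.1).sum
    let R := √(((triplets v).map fun t => (t.1 : ℝ) * t.2.1 ^ 2).sum / n)
    let C : Finset M := ((triplets v).map fun t => t.2.2).sup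
    let T := coverWithBalls sel C (γ / √(2 * β)) R Pi
    { val := T.val.support.val.map fun q => (i, .weighted q (T.val q))
      work := C.card + T.work + 8 }

/-- The two rounds of `MRcoreset(P, k, z, γ)`. -/
def mrCoreset (seqK : SeqKMeans M) (sel₁ sel₂ : Selector M) (part : M → ℕ) (L k z : ℕ) (β γ : ℝ) :
    List (Round (Value M)) :=
  [coresetRound1 seqK sel₁ part k z β γ, coresetRound2 sel₂ part L β γ]

/-- The last round: the coreset is gathered in a single reducer, which runs `seqW` on it, with
the parameters `k` and `z`, and emits the centers. -/
def solveRound (seqW : SeqWeightedKMeansOut M) (k z : ℕ) : Round (Value M) where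
  map
    | (_, .weighted q w) => { val := {(0, .weighted q w)}, work := 1 }
    | _ => { val := 0, work := 1 }
  reduce i v :=
    let T := weightedSet v
    let S := seqW T k z
    { val := S.val.val.map fun s => (i, .center s)
      work := 2 * T.support.card + S.work + S.val.card + 8 }

/-- The 3-round algorithm: `MRcoreset(P, ρ k, τ z, γ)`, followed by the sequential algorithm for
weighted k-means with outliers on the coreset. -/
def kMeansOutAlg (seqK : SeqKMeans M) (seqW : SeqWeightedKMeansOut M) (sel₁ sel₂ : Selector M)
    (part : M → ℕ) (L k z : ℕ) (ρ τ β γ : ℝ) : List (Round (Value M)) :=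
  mrCoreset seqK sel₁ sel₂ part L ⌊ρ * k⌋₊ ⌊τ * z⌋₊ β γ ++ [solveRound seqW k z]

/-- The input of the algorithm: the points of `P`, each in a pair of its own. -/
def inputPairs (P : Finset M) : Multiset (ℕ × Value M) :=
  P.val.map fun p => (0, .point p)

/-- The set of centers emitted by an algorithm on the input `P`. -/
def solution (alg : List (Round (Value M))) (P : Finset M) : Finset M :=
  centers ((run alg (inputPairs P)).map Prod.snd)

/-- The number of parts `L = (|P| / (ρ k + τ z))^{1/3}`, rounded up. -/
def numParts (P : Finset M) (k z : ℕ) (ρ τ : ℝ) : ℕ :=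
  ⌈((P.card : ℝ) / (ρ * k + τ * z)) ^ (1 / 3 : ℝ)⌉₊

end Algorithm

end KMeansOutliers

end

noncomputable section

namespace KMeansOutliers

/-! ### Sums over finite sets -/

/-! Costs are squared ℓ²-norms of vectors of distances, so Minkowski's inequality
(`sqrt_sum_sq_le_add`) turns a triangle inequality at each point into one between square roots of
costs. The coreset is handled through a proxy map `π` on `P` whose fibers are counted by the weights
(`CountsFibers`): weighted sums over the coreset are sums over `P`, and trimming weight amounts to
deleting points of `P`.

Quality. Let k' = ⌊ρk⌋ + ⌊τz⌋. For every nonempty X with at most k' points, the local solutions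
together cost at most 4β cost(P, X), and the precision γ/√(2β) then gives Σ d(p, π p)² ≤ (2γ)²
cost(P, X) (`Setup.IsAdmissible.moveCost_le`). With X = S ∪ Z, outliers become centers, so moving to
proxies costs 2γ√cost(P \ Z, S) in norm. For the output, (1 - 2γ)√cost on P is therefore at most
√cost on the coreset. For an optimal solution on P the centers must also move to their proxies,
which costs 3γ√OPT more (`Setup.IsAdmissible.sqrt_center_move_le`), so the coreset optimum is at
most (1 + 5γ)² OPT. `Setup.IsAdmissible.cost_le` combines the two bounds.

Memory. The points selected by `coverWithBalls` are classified by nearest center and by dyadic scale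
of the distance to it. A class is a separated set in a ball, hence small by the doubling property,
and O(log |P|) scales suffice because no distance exceeds √|P| · R (`card_coverWithBalls_le`). With
H = `Setup.coverFactor`, the union of the C_i has at most L k' H points and the coreset at most L²
k' H²; the choice of L balances this with the part size |P|/L (`numParts_bounds`). -/

theorem sqrt_sum_sq_le_add {ι : Type*} (s : Finset ι) (f g h : ι → ℝ)
    (hf : ∀ i ∈ s, 0 ≤ f i) (hfgh : ∀ i ∈ s, f i ≤ g i + h i) :
    √(∑ i ∈ s, f i ^ 2) ≤ √(∑ i ∈ s, g i ^ 2) + √(∑ i ∈ s, h i ^ 2) := by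
  have hG : 0 ≤ ∑ i ∈ s, g i ^ 2 := Finset.sum_nonneg fun i _ => sq_nonneg _
  have hH : 0 ≤ ∑ i ∈ s, h i ^ 2 := Finset.sum_nonneg fun i _ => sq_nonneg _
  apply Real.sqrt_le_iff.2 ⟨by positivity, ?_⟩
  calc ∑ i ∈ s, f i ^ 2 ≤ ∑ i ∈ s, (g i + h i) ^ 2 :=
        Finset.sum_le_sum fun i hi => pow_le_pow_left₀ (hf i hi) (hfgh i hi) 2
    _ = ∑ i ∈ s, g i ^ 2 + 2 * ∑ i ∈ s, g i * h i + ∑ i ∈ s, h i ^ 2 := by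
        rw [Finset.mul_sum, ← Finset.sum_add_distrib, ← Finset.sum_add_distrib]
        exact Finset.sum_congr rfl fun i _ => by ring
    _ ≤ _ := by
        -- Cauchy–Schwarz for the cross term.
        have := Real.sum_mul_le_sqrt_mul_sqrt s g h
        nlinarith [Real.sq_sqrt hG, Real.sq_sqrt hH]

/-- Stated for an arbitrary `f`, since outliers are taken both by the distance of a point to the
centers and by the distance of its proxy. -/
theorem exists_top_subset {M : Type*} (f : M → ℝ) (P : Finset M) (z : ℕ) :
    ∃ Z ⊆ P, Z.card = min z P.card ∧ ∀ p ∈ Z, ∀ q ∈ P \ Z, f q ≤ f p := by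
  induction z with
  | zero => exact ⟨∅, by simp⟩
  | succ z ih =>
    obtain ⟨Z, hZP, hZ, hf⟩ := ih
    rcases (P \ Z).eq_empty_or_nonempty with h | h
    · have : Z = P := hZP.antisymm (Finset.sdiff_eq_empty_iff_subset.1 h)
      subst this
      exact ⟨Z, hZP, by omega, by simp⟩
    · obtain ⟨m, hm, hmax⟩ := Finset.exists_max_image (P \ Z) f h
      rw [Finset.mem_sdiff] at hm
      refine ⟨insert m Z, Finset.insert_subset hm.1 hZP, ?_, ?_⟩
      · have := Finset.card_sdiff_of_subset hZP
        have := h.card_pos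
        rw [Finset.card_insert_of_notMem hm.2]
        omega
      · intro p hp q hq
        simp only [Finset.mem_sdiff, Finset.mem_insert, not_or] at hp hq
        have hq' : q ∈ P \ Z := Finset.mem_sdiff.2 ⟨hq.1, hq.2.2⟩
        rcases hp with rfl | hp
        · exact hmax q hq'
        · exact hf p hp q hq'

/-- Exchange argument: outside their intersection, `W` has at least as many points as `P \ Z`, and
each of them lies in `Z`, so its value is at least every value on `P \ Z`. -/
theorem sum_sdiff_top_le {M : Type*} (f : M → ℝ) (hf : ∀ p, 0 ≤ f p) (P Z W : Finset M)
    (hZ : Z ⊆ P) (htop : ∀ p ∈ Z, ∀ q ∈ P \ Z, f q ≤ f p) (hW : W ⊆ P)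
    (hcard : P.card ≤ W.card + Z.card) :
    ∑ p ∈ P \ Z, f p ≤ ∑ p ∈ W, f p := by
  set U := P \ Z with hU
  have hUc : U.card ≤ W.card := by
    have : U.card = P.card - Z.card := Finset.card_sdiff_of_subset hZ
    omega
  have h1 := Finset.card_sdiff_add_card_inter U W
  have h2 := Finset.card_sdiff_add_card_inter W U
  rw [Finset.inter_comm W U] at h2
  rw [← Finset.sum_inter_add_sum_sdiff U W, ← Finset.sum_inter_add_sum_sdiff W U,
    Finset.inter_comm W U]
  gcongr _ + ?_
  rcases (U \ W).eq_empty_or_nonempty with h | h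
  · rw [h, Finset.sum_empty]
    exact Finset.sum_nonneg fun p _ => hf p
  · obtain ⟨m, hm, hmax⟩ := Finset.exists_max_image (U \ W) f h
    calc ∑ p ∈ U \ W, f p ≤ (U \ W).card • f m := Finset.sum_le_card_nsmul _ _ _ hmax
      _ ≤ (W \ U).card • f m := nsmul_le_nsmul_left (hf m) (by omega)
      _ ≤ ∑ p ∈ W \ U, f p := by
        refine Finset.card_nsmul_le_sum _ _ _ fun p hp => ?_
        rw [Finset.mem_sdiff] at hp hm
        refine htop p ?_ m hm.1
        by_contra hpZ
        exact hp.2 (Finset.mem_sdiff.2 ⟨hW hp.1, hpZ⟩)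

/-! ### Proxy maps and the weights that count their fibers -/

section Fibers

variable {M : Type*} {W P : Finset M} {π : M → M} {w : M →₀ ℕ}

/-- `w` counts the points of `P` in the fibers of the proxy function `π`. -/
def CountsFibers (P : Finset M) (π : M → M) (w : M →₀ ℕ) : Prop :=
  ∀ q, w q = (P.filter fun p => π p = q).card

theorem CountsFibers.mem_support (h : CountsFibers P π w) {q : M} :
    q ∈ w.support ↔ ∃ p ∈ P, π p = q := by
  rw [Finsupp.mem_support_iff, h q, Finset.card_ne_zero]
  simp [Finset.Nonempty]

theorem CountsFibers.sum_eq (h : CountsFibers P π w) (g : M → ℝ) :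
    ∑ p ∈ P, g (π p) = ∑ q ∈ w.support, (w q : ℝ) * g q := by
  rw [← Finset.sum_fiberwise_of_maps_to (t := w.support) (g := π)
    fun p hp => h.mem_support.2 ⟨p, hp, rfl⟩]
  refine Finset.sum_congr rfl fun q _ => ?_
  rw [h q, Finset.sum_congr rfl fun p hp => by rw [(Finset.mem_filter.1 hp).2],
    Finset.sum_const, nsmul_eq_mul]

theorem CountsFibers.weight_eq (h : CountsFibers P π w) : weight w = P.card := by
  have := h.sum_eq fun _ => 1
  simp only [Finset.sum_const, nsmul_eq_mul, mul_one] at this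
  rw [weight]
  exact_mod_cast this.symm

/-- Turns a trimmed weight function into a set of surviving points: keep any `v q` points of the
fiber over `q`. -/
theorem CountsFibers.exists_subset (h : CountsFibers P π w) {v : M →₀ ℕ} (hv : ∀ p, v p ≤ w p) :
    ∃ W ⊆ P, CountsFibers W π v := by
  have : ∀ q, ∃ F ⊆ P.filter fun p => π p = q, F.card = v q := fun q =>
    Finset.exists_subset_card_eq (by rw [← h q]; exact hv q)
  choose F hF hFc using this
  refine ⟨P.filter fun p => p ∈ F (π p), Finset.filter_subset _ _, fun q => ?_⟩
  rw [← hFc q]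
  congr 1
  ext p
  simp only [Finset.mem_filter]
  constructor
  · intro hp
    have := Finset.mem_filter.1 (hF q hp)
    exact ⟨⟨this.1, this.2 ▸ hp⟩, this.2⟩
  · rintro ⟨⟨_, hp⟩, rfl⟩
    exact hp

theorem exists_countsFibers (P : Finset M) (π : M → M) : ∃ w, CountsFibers P π w :=
  ⟨Finsupp.onFinset (P.image π) (fun q => (P.filter fun p => π p = q).card) fun q hq => by
    obtain ⟨p, hp⟩ := Finset.card_ne_zero.1 hq
    rw [Finset.mem_filter] at hp
    exact Finset.mem_image.2 ⟨p, hp⟩, fun q => rfl⟩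

end Fibers

/-! ### Costs and optima -/

section Cost

variable {M : Type*} [MetricSpace M]

theorem cost_nonneg (P S : Finset M) : 0 ≤ cost P S := Finset.sum_nonneg fun _ _ => sq_nonneg _

theorem wcost_nonneg (w : M →₀ ℕ) (S : Finset M) : 0 ≤ wcost w S :=
  Finset.sum_nonneg fun _ _ => by positivity

theorem exists_infDist_eq {S : Finset M} (hS : S.Nonempty) (p : M) :
    ∃ s ∈ S, Metric.infDist p (S : Set M) = dist p s :=
  S.finite_toSet.isCompact.exists_infDist_eq_dist (by simpa using hS) p

theorem opt_le_cost {k : ℕ} {P S : Finset M} (h : IsSolution k P S) : opt k P ≤ cost P S := by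
  refine csInf_le ⟨0, ?_⟩ ⟨S, h, rfl⟩
  rintro _ ⟨S, _, rfl⟩
  exact cost_nonneg _ _

theorem woptOut_le_wcost {k z : ℕ} {w v : M →₀ ℕ} {S : Finset M} (h : IsSolution k w.support S)
    (hv : IsTrimmed z w S v) : woptOut k z w ≤ wcost v S := by
  refine csInf_le ⟨0, ?_⟩ ⟨S, v, h, hv, rfl⟩
  rintro _ ⟨S, v, _, _, rfl⟩
  exact wcost_nonneg _ _

/-- Only finitely many pairs of subsets of `P` compete, so the infimum is attained; a single center
shows that there is a competitor. -/
theorem exists_optOut_eq {k : ℕ} (z : ℕ) {P : Finset M} (hk : 1 ≤ k) (hP : P.Nonempty) :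
    ∃ S Z, IsSolution k P S ∧ IsOut z P S Z ∧ optOut k z P = cost (P \ Z) S := by
  apply Set.Nonempty.csInf_mem (s := {c | ∃ S Z, IsSolution k P S ∧ IsOut z P S Z ∧
    c = cost (P \ Z) S})
  · obtain ⟨p, hp⟩ := hP
    obtain ⟨Z, hZ⟩ := exists_top_subset
      (fun q => Metric.infDist q (({p} : Finset M) : Set M)) P z
    exact ⟨_, {p}, Z, ⟨by simpa using hp, by simp, by simpa using hk⟩, hZ, rfl⟩
  · refine Set.Finite.subset (((P.powerset ×ˢ P.powerset).image
      fun a => cost (P \ a.2) a.1).finite_toSet) ?_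
    rintro _ ⟨S, Z, hS, hZ, rfl⟩
    simp only [Finset.coe_image, Set.mem_image, SetLike.mem_coe, Finset.mem_product,
      Finset.mem_powerset]
    exact ⟨(S, Z), ⟨hS.1, hZ.1⟩, rfl⟩

/-- Restricting the centers to the point set costs at most a factor of four. -/
theorem opt_le_four_mul_cost {k : ℕ} {Q X : Finset M} (hQ : Q.Nonempty) (hX : X.Nonempty)
    (hXk : X.card ≤ k) : opt k Q ≤ 4 * cost Q X := by
  choose φ hφ hφd using fun x => exists_infDist_eq hQ x
  have hsol : IsSolution k Q (X.image φ) :=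
    ⟨Finset.image_subset_iff.2 fun x _ => hφ x, hX.image φ, Finset.card_image_le.trans hXk⟩
  refine (opt_le_cost hsol).trans ?_
  rw [cost, cost, Finset.mul_sum]
  refine Finset.sum_le_sum fun p hp => ?_
  obtain ⟨x, hx, hxd⟩ := exists_infDist_eq hX p
  have h1 : Metric.infDist p ((X.image φ : Finset M) : Set M) ≤ dist p (φ x) :=
    Metric.infDist_le_dist_of_mem (by simpa using ⟨x, hx, rfl⟩)
  -- `φ x` is a point of `Q` nearest to `x`, and `p` itself lies in `Q`. So `dist p (φ x) ≤ 2 * dist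
  -- p x`, and squaring gives the factor four.
  have h2 : dist x (φ x) ≤ dist x p := hφd x ▸ Metric.infDist_le_dist_of_mem (by simpa using hp)
  have h3 := dist_triangle p x (φ x)
  rw [dist_comm x p] at h2
  have h0 := Metric.infDist_nonneg (x := p) (s := ((X.image φ : Finset M) : Set M))
  rw [hxd]
  nlinarith

/-- Outliers may be turned into centers. -/
theorem cost_union_le {P S Z : Finset M} (hS : S.Nonempty) :
    cost P (S ∪ Z) ≤ cost (P \ Z) S := by
  rw [cost, cost, ← Finset.sum_inter_add_sum_sdiff P Z]
  have : ∑ p ∈ P ∩ Z, Metric.infDist p ((S ∪ Z : Finset M) : Set M) ^ 2 = 0 := by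
    refine Finset.sum_eq_zero fun p hp => ?_
    rw [Metric.infDist_zero_of_mem, zero_pow two_ne_zero]
    simp [(Finset.mem_inter.1 hp).2]
  rw [this, zero_add]
  refine Finset.sum_le_sum fun p _ => pow_le_pow_left₀ Metric.infDist_nonneg ?_ 2
  exact Metric.infDist_le_infDist_of_subset (by simp) (by simpa using hS)

/-- The cost of moving each point to its proxy. -/
def moveCost (P : Finset M) (π : M → M) : ℝ := ∑ p ∈ P, dist p (π p) ^ 2

/-- The weight `v` corresponds to |P| - z surviving points `W` of `P`. Removing the farthest points
is at least as good as keeping `W`, and on `W` each point is compared with its proxy. -/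
theorem sqrt_cost_sdiff_le {P S Z : Finset M} {π : M → M} {w v : M →₀ ℕ} {z : ℕ}
    (hw : CountsFibers P π w) (hZ : IsOut z P S Z) (hv : IsTrimmed z w S v) :
    √(cost (P \ Z) S) ≤ √(wcost v S) + √(moveCost P π) := by
  obtain ⟨W, hWP, hW⟩ := hw.exists_subset hv.1
  have hWc : W.card = P.card - z := by rw [← hW.weight_eq, hv.2.1, hw.weight_eq]
  have h1 : cost (P \ Z) S ≤ cost W S := by
    refine sum_sdiff_top_le _ (fun _ => sq_nonneg _) _ _ _ hZ.1 ?_ hWP ?_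
    · exact fun p hp q hq => pow_le_pow_left₀ Metric.infDist_nonneg (hZ.2.2 p hp q hq) 2
    · have := hZ.2.1
      omega
  calc √(cost (P \ Z) S) ≤ √(cost W S) := Real.sqrt_le_sqrt h1
    _ ≤ √(∑ p ∈ W, Metric.infDist (π p) (S : Set M) ^ 2) + √(moveCost W π) :=
        sqrt_sum_sq_le_add _ _ _ _ (fun _ _ => Metric.infDist_nonneg)
          fun p _ => Metric.infDist_le_infDist_add_dist
    _ ≤ _ := by
        rw [hW.sum_eq fun q => Metric.infDist q (S : Set M) ^ 2]
        exact add_le_add le_rfl (Real.sqrt_le_sqrt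
          (Finset.sum_le_sum_of_subset_of_nonneg hWP fun _ _ _ => sq_nonneg _))

/-- Centers for the weighted set must lie in its support, so each center is replaced by its proxy.
This produces the middle term, in which a center is counted once for every surviving point that it
serves. -/
theorem sqrt_woptOut_le {P S Z : Finset M} {π σ : M → M} {w : M →₀ ℕ} {k z : ℕ}
    (hw : CountsFibers P π w) (hS : IsSolution k P S) (hZ : Z ⊆ P) (hZz : Z.card ≤ z)
    (hσ : ∀ p, σ p ∈ S ∧ Metric.infDist p (S : Set M) = dist p (σ p)) :
    √(woptOut k z w) ≤ √(cost (P \ Z) S) +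
      √(∑ p ∈ P \ Z, dist (σ p) (π (σ p)) ^ 2) + √(moveCost P π) := by
  set S' := S.image π
  have hS' : IsSolution k w.support S' := by
    refine ⟨Finset.image_subset_iff.2 fun s hs => hw.mem_support.2 ⟨s, hS.1 hs, rfl⟩,
      hS.2.1.image π, Finset.card_image_le.trans hS.2.2⟩
  set f : M → ℝ := fun p => Metric.infDist (π p) (S' : Set M)
  -- The trimming is realized on `P`: delete the `z` points whose proxies are farthest from the
  -- moved centers and count the remaining fibers.
  obtain ⟨Y, hYP, hYc, hY⟩ := exists_top_subset f P z
  obtain ⟨v, hv⟩ := exists_countsFibers (P \ Y) π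
  have htrim : IsTrimmed z w S' v := by
    refine ⟨fun p => ?_, ?_, ?_⟩
    · rw [hw p, hv p]
      exact Finset.card_le_card (Finset.filter_subset_filter _ Finset.sdiff_subset)
    · rw [hv.weight_eq, hw.weight_eq, Finset.card_sdiff_of_subset hYP]
      omega
    · intro p q hp hq
      obtain ⟨b, hb, rfl⟩ := hv.mem_support.1 (Finsupp.mem_support_iff.2 hq.ne')
      -- A proxy that loses weight has a deleted point in its fiber, otherwise the two fiber counts
      -- would agree.
      have : ∃ a ∈ Y, π a = p := by
        by_contra! h
        refine hp.ne ?_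
        rw [hw p, hv p]
        congr 1
        ext a
        simp only [Finset.mem_filter, Finset.mem_sdiff]
        exact ⟨fun h' => ⟨h'.1.1, h'.2⟩, fun h' => ⟨⟨h'.1, fun ha => h a ha h'.2⟩, h'.2⟩⟩
      obtain ⟨a, ha, rfl⟩ := this
      exact hY a ha b hb
  have h1 : wcost v S' = ∑ p ∈ P \ Y, f p ^ 2 :=
    (hv.sum_eq fun q => Metric.infDist q (S' : Set M) ^ 2).symm
  have h2 : ∑ p ∈ P \ Y, f p ^ 2 ≤ ∑ p ∈ P \ Z, f p ^ 2 := by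
    refine sum_sdiff_top_le _ (fun _ => sq_nonneg _) _ _ _ hYP ?_ Finset.sdiff_subset ?_
    · exact fun p hp q hq => pow_le_pow_left₀ Metric.infDist_nonneg (hY p hp q hq) 2
    · have := Finset.card_sdiff_of_subset hZ
      have := Finset.card_le_card hZ
      omega
  calc √(woptOut k z w) ≤ √(∑ p ∈ P \ Z, f p ^ 2) :=
        Real.sqrt_le_sqrt ((woptOut_le_wcost hS' htrim).trans (h1.trans_le h2))
    _ ≤ √(∑ p ∈ P \ Z, (Metric.infDist p (S : Set M) + dist (σ p) (π (σ p))) ^ 2) +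
          √(moveCost (P \ Z) π) := by
        refine sqrt_sum_sq_le_add _ _ _ _ (fun _ _ => Metric.infDist_nonneg) fun p _ => ?_
        rw [(hσ p).2]
        refine (Metric.infDist_le_dist_of_mem (y := π (σ p)) ?_).trans ?_
        · simpa [S'] using ⟨σ p, (hσ p).1, rfl⟩
        · have := dist_triangle4 (π p) p (σ p) (π (σ p))
          rw [dist_comm (π p) p] at this
          linarith
    _ ≤ _ := by
        refine add_le_add ?_ (Real.sqrt_le_sqrt
          (Finset.sum_le_sum_of_subset_of_nonneg Finset.sdiff_subset fun _ _ _ => sq_nonneg _))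
        exact sqrt_sum_sq_le_add _ _ _ _
          (fun _ _ => add_nonneg Metric.infDist_nonneg dist_nonneg) fun _ _ => le_rfl

end Cost

/-! ### CoverWithBalls -/

section Cover

variable {M : Type*} [MetricSpace M] (sel : Selector M) (X : Finset M) (δ R : ℝ)

theorem coverWithBalls_empty : coverWithBalls sel X δ R ∅ = ⟨0, X.card + 8⟩ := by
  rw [coverWithBalls, dif_neg Finset.not_nonempty_empty]

/-- One induction gives the three facts used later: proxies are near, selected points are separated,
and the work space is linear. The separation is a disjunction because its threshold belongs to
whichever of the two points was selected later. The case `p = π p` stays apart because `δ` and `R`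
carry no sign here. -/
theorem coverWithBalls_spec (P : Finset M) :
    (∃ π : M → M, CountsFibers P π (coverWithBalls sel X δ R P).val ∧
      ∀ p ∈ P, π p ∈ P ∧ (p = π p ∨ dist p (π p) ≤ δ * max R (Metric.infDist p (X : Set M)))) ∧
    (∀ p ∈ (coverWithBalls sel X δ R P).val.support,
      ∀ q ∈ (coverWithBalls sel X δ R P).val.support, p ≠ q →
        δ * max R (Metric.infDist p (X : Set M)) < dist p q ∨
        δ * max R (Metric.infDist q (X : Set M)) < dist p q) ∧
    (coverWithBalls sel X δ R P).work ≤ X.card + 3 * P.card + 8 := by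
  induction P using Finset.strongInduction with
  | H P ih =>
    rcases P.eq_empty_or_nonempty with rfl | hP
    · rw [coverWithBalls_empty]
      exact ⟨⟨id, fun q => by simp, by simp⟩, by simp, by simp⟩
    · rw [coverWithBalls, dif_pos hP]
      set q := (sel P hP).1 with hq
      have hqP : q ∈ P := (sel P hP).2
      set B := P.filter fun p => p = q ∨ dist p q ≤ δ * max R (Metric.infDist p (X : Set M))
        with hB
      have hBP : B ⊆ P := Finset.filter_subset _ _
      have hqB : q ∈ B := Finset.mem_filter.2 ⟨hqP, Or.inl rfl⟩
      obtain ⟨⟨π, hπ, hπP⟩, hsep, hwork⟩ :=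
        ih (P \ B) (Finset.sdiff_ssubset hBP ⟨q, hqB⟩)
      set c := coverWithBalls sel X δ R (P \ B)
      have hsupp : ∀ p ∈ c.val.support, p ∈ P \ B := by
        intro p hp
        obtain ⟨a, ha, rfl⟩ := hπ.mem_support.1 hp
        exact (hπP a ha).1
      have hfar : ∀ p ∈ P \ B, δ * max R (Metric.infDist p (X : Set M)) < dist p q := by
        intro p hp
        simp only [hB, Finset.mem_sdiff, Finset.mem_filter, not_and, not_or, not_le] at hp
        exact (hp.2 hp.1).2
      have hmem : ∀ p ∈ (Finsupp.single q B.card + c.val).support,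
          p = q ∨ p ∈ c.val.support := by
        intro p hp
        by_contra! h
        rw [Finsupp.mem_support_iff, Finsupp.add_apply,
          Finsupp.single_eq_of_ne h.1, Finsupp.notMem_support_iff.1 h.2] at hp
        exact hp rfl
      refine ⟨⟨fun p => if p ∈ B then q else π p, fun s => ?_, fun p hp => ?_⟩, ?_, ?_⟩
      · rw [Finsupp.add_apply]
        by_cases hs : s = q
        · rw [hs]
          have : c.val q = 0 := Finsupp.notMem_support_iff.1 fun h =>
            (Finset.mem_sdiff.1 (hsupp _ h)).2 hqB
          rw [Finsupp.single_eq_same, this, add_zero]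
          congr 1
          ext p
          constructor
          · exact fun hp => Finset.mem_filter.2 ⟨hBP hp, if_pos hp⟩
          · intro hp
            obtain ⟨hp, h⟩ := Finset.mem_filter.1 hp
            refine of_not_not fun (hpB : p ∉ B) => ?_
            simp only [if_neg hpB] at h
            have := (hπP p (Finset.mem_sdiff.2 ⟨hp, hpB⟩)).1
            rw [h] at this
            exact (Finset.mem_sdiff.1 this).2 hqB
        · rw [Finsupp.single_eq_of_ne hs, zero_add, hπ s]
          congr 1
          ext p
          simp only [Finset.mem_filter, Finset.mem_sdiff]
          constructor
          · rintro ⟨⟨hp, hpB⟩, h⟩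
            exact ⟨hp, by rwa [if_neg hpB]⟩
          · rintro ⟨hp, h⟩
            by_cases hpB : p ∈ B
            · rw [if_pos hpB] at h
              exact absurd h.symm hs
            · rw [if_neg hpB] at h
              exact ⟨⟨hp, hpB⟩, h⟩
      · by_cases hpB : p ∈ B
        · simp only [if_pos hpB]
          exact ⟨hqP, (Finset.mem_filter.1 hpB).2⟩
        · simp only [if_neg hpB]
          have := hπP p (Finset.mem_sdiff.2 ⟨hp, hpB⟩)
          exact ⟨(Finset.mem_sdiff.1 this.1).1, this.2⟩
      · intro p hp s hs hps
        rcases hmem p hp with h1 | h1 <;> rcases hmem s hs with h2 | h2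
        · exact absurd (h1.trans h2.symm) hps
        · rw [h1, dist_comm]
          exact Or.inr (hfar s (hsupp s h2))
        · rw [h2]
          exact Or.inl (hfar p (hsupp p h1))
        · exact hsep p h1 s h2 hps
      · have h1 := Finset.card_sdiff_of_subset hBP
        have h2 := Finset.card_pos.2 ⟨q, hqB⟩
        have h3 := Finset.card_le_card hBP
        change max _ (c.work + 2) ≤ _
        omega

end Cover

/-! ### The doubling dimension -/

section Doubling

variable {M : Type*} [MetricSpace M]

/-- `D` satisfies the covering condition that defines the doubling dimension. -/
def IsDoubling (P : Finset M) (D : ℝ) : Prop :=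
  ∀ p ∈ P, ∀ r : ℝ, 0 < r → ∃ Q ⊆ P, (Q.card : ℝ) ≤ (2 : ℝ) ^ D ∧
    ∀ x ∈ P, dist x p ≤ r → ∃ q ∈ Q, dist x q ≤ r / 2

theorem IsDoubling.nonneg {P : Finset M} (hP : P.Nonempty) {D : ℝ} (h : IsDoubling P D) :
    0 ≤ D := by
  obtain ⟨p, hp⟩ := hP
  obtain ⟨Q, _, hQc, hQ⟩ := h p hp 1 one_pos
  obtain ⟨q, hq, _⟩ := hQ p hp (by simp)
  have h1 : (1 : ℝ) ≤ Q.card := by exact_mod_cast Finset.card_pos.2 ⟨q, hq⟩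
  by_contra! hD
  have := Real.rpow_lt_one_of_one_lt_of_neg one_lt_two hD
  linarith

/-- Keeps the infimum that defines the doubling dimension from being taken over the empty set: all
of `P` is a cover, and n ≤ 2ⁿ. -/
theorem exists_isDoubling (P : Finset M) : IsDoubling P P.card := by
  intro p _ r hr
  refine ⟨P, subset_rfl, ?_, fun x hx _ => ⟨x, hx, by rw [dist_self]; positivity⟩⟩
  rw [Real.rpow_natCast]
  exact_mod_cast Nat.lt_two_pow_self.le

theorem doublingDim_nonneg {P : Finset M} (hP : P.Nonempty) : 0 ≤ doublingDim P :=
  le_csInf ⟨_, exists_isDoubling P⟩ fun _ h => IsDoubling.nonneg hP h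

/-- The infimum in the definition of the doubling dimension is attained. -/
theorem isDoubling_doublingDim {P : Finset M} : IsDoubling P (doublingDim P) := by
  set D := doublingDim P with hD
  -- A cover has an integer number of balls, so only the floor of `2 ^ D` matters, and an admissible
  -- exponent slightly above `D` leaves no room for a larger integer.
  have hlt : (2 : ℝ) ^ D < ⌊(2 : ℝ) ^ D⌋₊ + 1 := Nat.lt_floor_add_one _
  have hcont : ∀ᶠ x in nhds D, (2 : ℝ) ^ x < ⌊(2 : ℝ) ^ D⌋₊ + 1 :=
    (Real.continuous_const_rpow two_ne_zero).continuousAt.eventually_lt_const hlt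
  obtain ⟨ε, hε, hball⟩ := Metric.eventually_nhds_iff.1 hcont
  obtain ⟨E, hE, hEε⟩ := exists_lt_of_csInf_lt (s := {D : ℝ | IsDoubling P D})
    ⟨_, exists_isDoubling P⟩ (show sInf {D : ℝ | IsDoubling P D} < D + ε by
      change doublingDim P < _
      linarith)
  have hE2 : (2 : ℝ) ^ E < ⌊(2 : ℝ) ^ D⌋₊ + 1 := by
    rcases le_or_gt E D with h | h
    · exact (Real.rpow_le_rpow_of_exponent_le one_le_two h).trans_lt hlt
    · refine hball ?_
      rw [Real.dist_eq, abs_of_pos (by linarith)]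
      linarith
  intro p hp r hr
  obtain ⟨Q, hQP, hQ, hcov⟩ := hE p hp r hr
  refine ⟨Q, hQP, ?_, hcov⟩
  have h1 : (Q.card : ℝ) < ⌊(2 : ℝ) ^ D⌋₊ + 1 := hQ.trans_lt hE2
  have h2 : Q.card ≤ ⌊(2 : ℝ) ^ D⌋₊ := Nat.lt_succ_iff.1 (by exact_mod_cast h1)
  exact (Nat.cast_le.2 h2).trans (Nat.floor_le (by positivity))

theorem IsDoubling.exists_cover {P : Finset M} {D : ℝ} (h : IsDoubling P D) (t : ℕ) {p : M}
    (hp : p ∈ P) {r : ℝ} (hr : 0 < r) :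
    ∃ Q ⊆ P, (Q.card : ℝ) ≤ ((2 : ℝ) ^ D) ^ t ∧
      ∀ x ∈ P, dist x p ≤ r → ∃ q ∈ Q, dist x q ≤ r / 2 ^ t := by
  induction t with
  | zero => exact ⟨{p}, by simpa using hp, by simp, fun x _ hx => ⟨p, by simp, by simpa using hx⟩⟩
  | succ t ih =>
    obtain ⟨Q, hQP, hQc, hQ⟩ := ih
    have : ∀ q : M, ∃ N ⊆ P, (N.card : ℝ) ≤ (2 : ℝ) ^ D ∧
        (q ∈ Q → ∀ x ∈ P, dist x q ≤ r / 2 ^ t → ∃ y ∈ N, dist x y ≤ r / 2 ^ t / 2) := by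
      intro q
      by_cases hq : q ∈ Q
      · obtain ⟨N, h1, h2, h3⟩ := h q (hQP hq) (r / 2 ^ t) (by positivity)
        exact ⟨N, h1, h2, fun _ => h3⟩
      · exact ⟨∅, by simp, by simp; positivity, fun h => absurd h hq⟩
    choose N hNP hNc hN using this
    refine ⟨Q.biUnion N, Finset.biUnion_subset.2 fun q _ => hNP q, ?_, fun x hx hxp => ?_⟩
    · calc ((Q.biUnion N).card : ℝ) ≤ ∑ q ∈ Q, ((N q).card : ℝ) := by
            exact_mod_cast Finset.card_biUnion_le
        _ ≤ Q.card • (2 : ℝ) ^ D := Finset.sum_le_card_nsmul _ _ _ fun q _ => hNc q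
        _ ≤ _ := by
          rw [nsmul_eq_mul, pow_succ]
          gcongr
    · obtain ⟨q, hq, hqd⟩ := hQ x hx hxp
      obtain ⟨y, hy, hyd⟩ := hN q hq x hx hqd
      exact ⟨y, Finset.mem_biUnion.2 ⟨q, hq, hy⟩, hyd.trans_eq (by rw [pow_succ]; field_simp)⟩

/-- A set of points in a ball of radius `r` with mutual distances greater than `δ r / 2` has at
most `(8 / δ) ^ D` points. -/
theorem IsDoubling.card_le_of_separated {P : Finset M} {D : ℝ} (h : IsDoubling P D) (hD : 0 ≤ D)
    {δ r : ℝ} (hδ : 0 < δ) (hδ1 : δ ≤ 4) {x : M} (hx : x ∈ P) {U : Finset M} (hU : U ⊆ P)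
    (hUr : ∀ p ∈ U, dist p x ≤ r)
    (hsep : ∀ p ∈ U, ∀ q ∈ U, p ≠ q → δ * r / 2 < dist p q) :
    (U.card : ℝ) ≤ (8 / δ) ^ D := by
  have hF : (1 : ℝ) ≤ (8 / δ) ^ D :=
    Real.one_le_rpow ((one_le_div hδ).2 (by linarith)) hD
  -- The doubling condition speaks of positive radii only; for `r ≤ 0` the set has at most the point
  -- `x`.
  rcases le_or_gt r 0 with hr | hr
  · have : U ⊆ {x} := fun p hp => by
      rw [Finset.mem_singleton]
      exact dist_le_zero.1 ((hUr p hp).trans hr)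
    have := Finset.card_le_card this
    rw [Finset.card_singleton] at this
    exact le_trans (by exact_mod_cast this) hF
  · obtain ⟨t, ht1, ht2⟩ := exists_nat_pow_near ((one_le_div hδ).2 hδ1) one_lt_two
    obtain ⟨Q, hQP, hQc, hQ⟩ := h.exists_cover (t + 1) hx hr
    choose! φ hφ hφd using fun p hp => hQ p (hU hp) (hUr p hp)
    have hinj : Set.InjOn φ U := by
      intro p hp q hq hpq
      by_contra hne
      have h1 := hsep p hp q hq hne
      have h2 := hφd p hp
      have h3 := hφd q hq
      rw [← hpq] at h3
      have h4 := dist_triangle_right p q (φ p)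
      have h5 : r / 2 ^ (t + 1) < r * (δ / 4) := by
        rw [div_eq_mul_inv]
        gcongr
        rw [inv_lt_comm₀ (by positivity) (by positivity), inv_div]
        exact ht2
      linarith
    have hcard : U.card ≤ Q.card := Finset.card_le_card_of_injOn φ hφ hinj
    calc (U.card : ℝ) ≤ Q.card := by exact_mod_cast hcard
      _ ≤ ((2 : ℝ) ^ D) ^ (t + 1) := hQc
      _ = ((2 : ℝ) ^ (t + 1)) ^ D := by
        rw [← Real.rpow_natCast, ← Real.rpow_mul (by norm_num), mul_comm,
          Real.rpow_mul (by norm_num), Real.rpow_natCast]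
      _ ≤ _ := by
        refine Real.rpow_le_rpow (by positivity) ?_ hD
        rw [pow_succ]
        calc (2 : ℝ) ^ t * 2 ≤ 4 / δ * 2 := by gcongr
          _ = 8 / δ := by ring

/-- The size of the output of `CoverWithBalls`. -/
theorem card_coverWithBalls_le {P : Finset M} {D : ℝ} (h : IsDoubling P D) (hD : 0 ≤ D)
    {δ R : ℝ} (hδ : 0 < δ) (hδ1 : δ ≤ 4) (hR : 0 ≤ R) (sel : Selector M) {X Q : Finset M}
    (hX : X.Nonempty) (hXP : X ⊆ P) (hQP : Q ⊆ P) (J : ℕ)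
    (hJ : ∀ p ∈ Q, Metric.infDist p (X : Set M) ≤ 2 ^ J * R) :
    ((coverWithBalls sel X δ R Q).val.support.card : ℝ) ≤ X.card * ((J + 1) * (8 / δ) ^ D) := by
  obtain ⟨⟨π, hπ, hπQ⟩, hsep, -⟩ := coverWithBalls_spec sel X δ R Q
  set T := (coverWithBalls sel X δ R Q).val.support
  have hTQ : T ⊆ Q := fun q hq => by
    obtain ⟨p, hp, rfl⟩ := hπ.mem_support.1 hq
    exact (hπQ p hp).1
  choose s hs hsd using fun p => exists_infDist_eq hX p
  -- The level of `p` is the least `j` with d(p, X) ≤ 2^j R. By minimality max(R, d(p, X)) is at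
  -- least half of 2^j R, so the points of one class are separated at the scale of their ball.
  have hlevel : ∀ p ∈ T, ∃ j ≤ J, Metric.infDist p (X : Set M) ≤ 2 ^ j * R ∧
      2 ^ j * R / 2 ≤ max R (Metric.infDist p (X : Set M)) := by
    intro p hp
    have hex : ∃ j, Metric.infDist p (X : Set M) ≤ 2 ^ j * R := ⟨J, hJ p (hTQ hp)⟩
    refine ⟨Nat.find hex, Nat.find_min' hex (hJ p (hTQ hp)), Nat.find_spec hex, ?_⟩
    rcases hj : Nat.find hex with _ | j
    · rw [pow_zero, one_mul]
      exact le_max_of_le_left (by linarith)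
    · have := Nat.find_min hex (m := j) (by omega)
      rw [not_le] at this
      refine le_max_of_le_right (le_trans (le_of_eq ?_) this.le)
      rw [pow_succ]
      ring
  choose! l hl hlle hlge using hlevel
  have hmaps : ∀ p ∈ T, (s p, l p) ∈ X ×ˢ Finset.range (J + 1) := fun p hp => by
    rw [Finset.mem_product, Finset.mem_range]
    exact ⟨hs p, Nat.lt_succ_of_le (hl p hp)⟩
  rw [Finset.card_eq_sum_card_fiberwise hmaps, Nat.cast_sum]
  refine (Finset.sum_le_card_nsmul _ _ ((8 / δ) ^ D) ?_).trans_eq ?_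
  · rintro ⟨x, j⟩ hxj
    rw [Finset.mem_product] at hxj
    refine h.card_le_of_separated hD (r := 2 ^ j * R) hδ hδ1 (hXP hxj.1)
      ((Finset.filter_subset _ _).trans (hTQ.trans hQP)) ?_ ?_
    · intro p hp
      obtain ⟨hpT, hp'⟩ := Finset.mem_filter.1 hp
      obtain ⟨rfl, rfl⟩ := Prod.mk.inj hp'
      rw [← hsd]
      exact hlle p hpT
    · intro p hp q hq hpq
      obtain ⟨hpT, hp'⟩ := Finset.mem_filter.1 hp
      obtain ⟨rfl, rfl⟩ := Prod.mk.inj hp'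
      obtain ⟨hqT, hq'⟩ := Finset.mem_filter.1 hq
      have h1 := mul_le_mul_of_nonneg_left (hlge p hpT) hδ.le
      have h2 := mul_le_mul_of_nonneg_left (hlge q hqT) hδ.le
      rw [(Prod.mk.inj hq').2] at h2
      rw [mul_div_assoc]
      rcases hsep p hpT q hqT hpq with h3 | h3
      · exact h1.trans_lt h3
      · exact h2.trans_lt h3
  · rw [Finset.card_product, Finset.card_range, nsmul_eq_mul]
    push_cast
    ring

end Doubling

/-! ### Executions of MapReduce rounds -/

section Execution

variable {V : Type*}

theorem group_add (x y : Multiset (ℕ × V)) (i : ℕ) : group (x + y) i = group x i + group y i := by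
  simp [group]

theorem group_bind {ι : Type*} (s : Multiset ι) (f : ι → Multiset (ℕ × V)) (i : ℕ) :
    group (s.bind f) i = s.bind fun a => group (f a) i := by
  simp [group, Multiset.filter_bind, Multiset.map_bind]

theorem group_map {ι : Type*} (s : Multiset ι) (κ : ι → ℕ) (f : ι → V) (i : ℕ) :
    group (s.map fun a => (κ a, f a)) i = (s.filter fun a => κ a = i).map f := by
  simp [group, Multiset.filter_map]

theorem group_range_map (L : ℕ) (b : V) {i : ℕ} (hi : i < L) :
    group ((Multiset.range L).map fun j => (j, b)) i = {b} := by
  rw [group_map (κ := fun j => j) (f := fun _ => b), Multiset.filter_eq',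
    Multiset.count_eq_one_of_mem (Multiset.nodup_range L) (Multiset.mem_range.2 hi)]
  simp

theorem keys_map {ι : Type*} (s : Multiset ι) (κ : ι → ℕ) (f : ι → V) :
    keys (s.map fun a => (κ a, f a)) = (s.map κ).toFinset := by
  simp [keys]

theorem keys_add (x y : Multiset (ℕ × V)) : keys (x + y) = keys x ∪ keys y := by
  simp [keys]

theorem pairWords_add (size : V → ℕ) (x y : Multiset (ℕ × V)) :
    pairWords size (x + y) = pairWords size x + pairWords size y := by
  simp [pairWords]

theorem pairWords_map {ι : Type*} (size : V → ℕ) (s : Multiset ι) (κ : ι → ℕ) (f : ι → V) :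
    pairWords size (s.map fun a => (κ a, f a)) = (s.map fun a => 1 + size (f a)).sum := by
  simp [pairWords]

theorem pairWords_singleton (size : V → ℕ) (a : ℕ × V) :
    pairWords size {a} = 1 + size a.2 := by
  simp [pairWords]

theorem Round.memory_le {size : V → ℕ} {r : Round V} {x y : Multiset (ℕ × V)} {N : ℕ}
    (hy : r.mapped x = y) (hmap : ∀ a ∈ x, r.mapMemory size a ≤ N)
    (hred : ∀ i ∈ keys y, r.reduceMemory size i (group y i) ≤ N) : r.memory size x ≤ N := by
  subst hy
  refine max_le (Multiset.sup_le.2 fun b hb => ?_) (Finset.sup_le hred)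
  obtain ⟨a, ha, rfl⟩ := Multiset.mem_map.1 hb
  exact hmap a ha

end Execution

/-! ### Reading off points, triplets, weights and centers from multisets of values -/

section Values

variable {M : Type*}

theorem filterMap_none {α β : Type*} (s : Multiset α) :
    s.filterMap (fun _ => (none : Option β)) = 0 := by
  induction s using Multiset.induction_on with
  | empty => rfl
  | cons a s ih => rw [Multiset.filterMap_cons_none _ _ rfl, ih]

theorem filterMap_some_map {α β : Type*} (f : α → β) (s : Multiset α) :
    s.filterMap (fun a => some (f a)) = s.map f :=
  congrFun (Multiset.filterMap_eq_map f) s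

theorem points_add (u v : Multiset (Value M)) : points (u + v) = points u ∪ points v := by
  simp [points]

theorem triplets_add (u v : Multiset (Value M)) :
    triplets (u + v) = triplets u + triplets v := by
  simp [triplets]

theorem points_map_point (Q : Finset M) : points (Q.val.map .point) = Q := by
  simp [points, Multiset.filterMap_map, Function.comp_def, Value.getPoint]

theorem triplets_map_point (Q : Finset M) : triplets (Q.val.map .point) = 0 := by
  simp only [triplets, Multiset.filterMap_map, Function.comp_def, Value.getTriplet]
  exact filterMap_none _

theorem points_map_triplet {ι : Type*} (s : Multiset ι) (n : ι → ℕ) (R : ι → ℝ)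
    (C : ι → Finset M) : points (s.map fun j => .triplet (n j) (R j) (C j)) = ∅ := by
  simp only [points, Multiset.filterMap_map, Function.comp_def, Value.getPoint]
  rw [filterMap_none, Multiset.toFinset_zero]

theorem triplets_map_triplet {ι : Type*} (s : Multiset ι) (n : ι → ℕ) (R : ι → ℝ)
    (C : ι → Finset M) :
    triplets (s.map fun j => .triplet (n j) (R j) (C j)) = s.map fun j => (n j, R j, C j) := by
  simp only [triplets, Multiset.filterMap_map, Function.comp_def, Value.getTriplet]
  exact filterMap_some_map _ s

theorem weightedSet_add (u v : Multiset (Value M)) :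
    weightedSet (u + v) = weightedSet u + weightedSet v := by
  simp [weightedSet]

theorem weightedSet_map_weighted (w : M →₀ ℕ) :
    weightedSet (w.support.val.map fun q => .weighted q (w q)) = w := by
  rw [weightedSet, Multiset.filterMap_map]
  have : (Value.getWeighted ∘ fun q : M => Value.weighted q (w q)) = fun q => some (q, w q) := rfl
  rw [this, filterMap_some_map, Multiset.map_map]
  exact w.sum_single

theorem weightedSet_bind {ι : Type*} (s : Multiset ι) (f : ι → Multiset (Value M)) :
    weightedSet (s.bind f) = (s.map fun i => weightedSet (f i)).sum := by
  induction s using Multiset.induction_on with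
  | empty => simp [weightedSet]
  | cons a s ih => simp [weightedSet_add, ih]

theorem centers_map_center (S : Finset M) : centers (S.val.map .center) = S := by
  simp [centers, Multiset.filterMap_map, Function.comp_def, Value.getCenter]

end Values

/-! ### The trace of the algorithm -/

section Trace

variable {M : Type*}

/-- The part `P_i`. -/
def piece (P : Finset M) (part : M → ℕ) (i : ℕ) : Finset M := P.filter fun p => part p = i

theorem bind_piece {P : Finset M} {part : M → ℕ} {L : ℕ} (h : ∀ p ∈ P, part p < L) :
    ((Multiset.range L).bind fun i => (piece P part i).val) = P.val := by
  have hd : ∀ p ∈ P, part p ∈ Finset.range L := fun p hp => Finset.mem_range.2 (h p hp)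
  exact congrArg Finset.val (Finset.disjiUnion_filter_eq_of_maps_to hd)

theorem group_map_part (P : Finset M) (part : M → ℕ) (i : ℕ) :
    group (P.val.map fun p => (part p, Value.point p)) i = (piece P part i).val.map .point :=
  group_map _ _ _ _

/-- The ingredients of an execution: the point set, the partition, the parameters and the
procedures that the first two rounds depend on. -/
structure Setup (M : Type*) where
  P : Finset M
  part : M → ℕ
  L : ℕ
  k : ℕ
  z : ℕ
  β : ℝ
  γ : ℝ
  seqK : SeqKMeans M
  sel₁ : Selector M
  sel₂ : Selector M

namespace Setup

variable (a : Setup M)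

/-- The part `P_i`. -/
def Pi (i : ℕ) : Finset M := piece a.P a.part i

/-- The requirements on the partition. -/
structure IsValid : Prop where
  part_lt : ∀ p ∈ a.P, a.part p < a.L
  nonempty : ∀ i < a.L, (a.Pi i).Nonempty
  pos : 0 < a.L

variable {a}

theorem mem_Pi {i : ℕ} {p : M} : p ∈ a.Pi i ↔ p ∈ a.P ∧ a.part p = i := Finset.mem_filter

theorem Pi_subset (i : ℕ) : a.Pi i ⊆ a.P := Finset.filter_subset _ _

theorem IsValid.sum_Pi (h : a.IsValid) {N : Type*} [AddCommMonoid N] (f : M → N) :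
    ∑ i ∈ Finset.range a.L, ∑ p ∈ a.Pi i, f p = ∑ p ∈ a.P, f p :=
  Finset.sum_fiberwise_of_maps_to (fun p hp => Finset.mem_range.2 (h.part_lt p hp)) f

theorem IsValid.sum_card (h : a.IsValid) :
    ∑ i ∈ Finset.range a.L, (a.Pi i).card = a.P.card := by
  simpa using h.sum_Pi fun _ => (1 : ℕ)

/-- As no part is empty, every index below `L` occurs as a key, so that all `L` reducers run. -/
theorem IsValid.map_part (h : a.IsValid) :
    (a.P.val.map a.part).toFinset = Finset.range a.L := by
  ext i
  simp only [Multiset.mem_toFinset, Multiset.mem_map, Finset.mem_val, Finset.mem_range]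
  constructor
  · rintro ⟨p, hp, rfl⟩
    exact h.part_lt p hp
  · intro hi
    obtain ⟨p, hp⟩ := h.nonempty i hi
    exact ⟨p, mem_Pi.1 hp⟩

variable (a) [MetricSpace M]

/-- The result of the k-means algorithm on `P_i`. -/
def centers₁ (i : ℕ) : Metered (Finset M) := a.seqK (a.Pi i) (a.k + a.z)

/-- The radius `R_i`. -/
def radius₁ (i : ℕ) : ℝ := √(cost (a.Pi i) (a.centers₁ i).val / (a.Pi i).card)

/-- The result of `CoverWithBalls` in the first round. -/
def cover₁ (i : ℕ) : Metered (M →₀ ℕ) :=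
  coverWithBalls a.sel₁ (a.centers₁ i).val (a.γ / √(2 * a.β)) (a.radius₁ i) (a.Pi i)

/-- The set `C_i`. -/
def C (i : ℕ) : Finset M := (a.cover₁ i).val.support

/-- The union of the sets `C_i`. -/
def union : Finset M := (Finset.range a.L).sup a.C

/-- The radius `R`. -/
def radius₂ : ℝ :=
  √((∑ i ∈ Finset.range a.L, ((a.Pi i).card : ℝ) * a.radius₁ i ^ 2) / a.P.card)

/-- The result of `CoverWithBalls` in the second round. -/
def cover₂ (i : ℕ) : Metered (M →₀ ℕ) :=
  coverWithBalls a.sel₂ a.union (a.γ / √(2 * a.β)) a.radius₂ (a.Pi i)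

/-- The coreset. -/
def coreset : M →₀ ℕ := ∑ i ∈ Finset.range a.L, (a.cover₂ i).val

/-- The triplet `(|P_i|, R_i, C_i)`. -/
def triplet (i : ℕ) : Value M := .triplet (a.Pi i).card (a.radius₁ i) (a.C i)

/-- The first round. -/
def round₁ : Round (Value M) := coresetRound1 a.seqK a.sel₁ a.part a.k a.z a.β a.γ

/-- The second round. -/
def round₂ : Round (Value M) := coresetRound2 a.sel₂ a.part a.L a.β a.γ

/-- The output of the first round. -/
def pairs₁ : Multiset (ℕ × Value M) :=
  (a.P.val.map fun p => (a.part p, .point p)) +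
    (Multiset.range a.L).map fun i => (i, a.triplet i)

/-- The pairs emitted by the map functions of the second round. -/
def mapped₂ : Multiset (ℕ × Value M) :=
  (a.P.val.map fun p => (a.part p, .point p)) +
    (Multiset.range a.L).bind fun i => (Multiset.range a.L).map fun j => (j, a.triplet i)

/-- The output of the second round. -/
def pairs₂ : Multiset (ℕ × Value M) :=
  (Multiset.range a.L).bind fun i =>
    (a.cover₂ i).val.support.val.map fun q => (i, .weighted q ((a.cover₂ i).val q))

/-- The pairs emitted by the map functions of the third round. -/
def mapped₃ : Multiset (ℕ × Value M) :=
  (Multiset.range a.L).bind fun i =>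
    (a.cover₂ i).val.support.val.map fun q => (0, .weighted q ((a.cover₂ i).val q))

variable {a}

theorem radius₁_nonneg (i : ℕ) : 0 ≤ a.radius₁ i := Real.sqrt_nonneg _

theorem radius₂_nonneg : 0 ≤ a.radius₂ := Real.sqrt_nonneg _

theorem mapped_inputPairs :
    a.round₁.mapped (inputPairs a.P) = a.P.val.map fun p => (a.part p, .point p) := by
  rw [Round.mapped, inputPairs, Multiset.bind_map]
  exact Multiset.bind_singleton _ _

theorem reduce_round₁ (i : ℕ) :
    a.round₁.reduce i ((a.Pi i).val.map .point) =
      { val := ((a.Pi i).val.map fun p => (i, .point p)) + {(i, a.triplet i)}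
        work := (a.centers₁ i).work + (a.centers₁ i).val.card + (a.cover₁ i).work + 8 } := by
  simp only [round₁, coresetRound1, points_map_point]
  rfl

theorem IsValid.exec_round₁ (h : a.IsValid) : a.round₁.exec (inputPairs a.P) = a.pairs₁ := by
  have hg : ∀ i, group (a.P.val.map fun p => (a.part p, Value.point p)) i =
      (a.Pi i).val.map .point := fun i => group_map_part a.P a.part i
  rw [Round.exec, mapped_inputPairs, keys_map, h.map_part]
  simp only [hg, reduce_round₁]
  rw [Multiset.bind_add, Finset.range_val, Multiset.bind_singleton, pairs₁,
    ← bind_piece h.part_lt, Multiset.map_bind]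
  congr 1
  refine Multiset.bind_congr fun i _ => Multiset.map_congr rfl fun p hp => ?_
  rw [(mem_Pi.1 hp).2]

theorem mapped_pairs₁ : a.round₂.mapped a.pairs₁ = a.mapped₂ := by
  rw [Round.mapped, pairs₁, mapped₂, Multiset.add_bind, Multiset.bind_map, Multiset.bind_map]
  congr 1
  exact Multiset.bind_singleton _ _

theorem IsValid.keys_mapped₂ (h : a.IsValid) : keys a.mapped₂ = Finset.range a.L := by
  rw [mapped₂, keys_add, keys_map, h.map_part, Finset.union_eq_left]
  intro i
  simp only [keys, Multiset.mem_toFinset, Multiset.mem_map, Multiset.mem_bind,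
    Multiset.mem_range, Finset.mem_range]
  rintro ⟨_, ⟨_, _, j, hj, rfl⟩, rfl⟩
  exact hj

theorem group_mapped₂ {i : ℕ} (hi : i < a.L) :
    group a.mapped₂ i = (a.Pi i).val.map .point + (Multiset.range a.L).map a.triplet := by
  rw [mapped₂, group_add, group_map_part, group_bind]
  congr 1
  rw [← Multiset.bind_singleton]
  exact Multiset.bind_congr fun j _ => group_range_map _ _ hi

theorem IsValid.reduce_round₂ (h : a.IsValid) (i : ℕ) :
    a.round₂.reduce i ((a.Pi i).val.map .point + (Multiset.range a.L).map a.triplet) =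
      { val := (a.cover₂ i).val.support.val.map fun q => (i, .weighted q ((a.cover₂ i).val q))
        work := a.union.card + (a.cover₂ i).work + 8 } := by
  have h1 : points ((a.Pi i).val.map .point + (Multiset.range a.L).map a.triplet) = a.Pi i := by
    rw [points_add, points_map_point]
    unfold triplet
    rw [points_map_triplet, Finset.union_empty]
  have h2 : triplets ((a.Pi i).val.map .point + (Multiset.range a.L).map a.triplet) =
      (Multiset.range a.L).map fun j => ((a.Pi j).card, a.radius₁ j, a.C j) := by
    rw [triplets_add, triplets_map_point, zero_add]
    unfold triplet
    rw [triplets_map_triplet]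
  have h3 : ((Multiset.range a.L).map fun j => (a.Pi j).card).sum = a.P.card := h.sum_card
  simp only [round₂, coresetRound2, h1, h2, Multiset.map_map, Function.comp_def, h3]
  rfl

theorem IsValid.exec_round₂ (h : a.IsValid) : a.round₂.exec a.pairs₁ = a.pairs₂ := by
  rw [Round.exec, mapped_pairs₁, h.keys_mapped₂, pairs₂, Finset.range_val]
  refine Multiset.bind_congr fun i hi => ?_
  rw [group_mapped₂ (Multiset.mem_range.1 hi), h.reduce_round₂]

variable (seqW : SeqWeightedKMeansOut M) (k z : ℕ)

theorem mapped_pairs₂ : (solveRound seqW k z).mapped a.pairs₂ = a.mapped₃ := by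
  rw [Round.mapped, pairs₂, mapped₃, Multiset.bind_assoc]
  refine Multiset.bind_congr fun i _ => ?_
  rw [Multiset.bind_map]
  exact Multiset.bind_singleton _ _

theorem IsValid.support_nonempty (h : a.IsValid) {i : ℕ} (hi : i < a.L) :
    (a.cover₂ i).val.support.Nonempty := by
  obtain ⟨⟨π, hπ, -⟩, -, -⟩ := coverWithBalls_spec a.sel₂ a.union (a.γ / √(2 * a.β)) a.radius₂
    (a.Pi i)
  obtain ⟨p, hp⟩ := h.nonempty i hi
  exact ⟨π p, hπ.mem_support.2 ⟨p, hp, rfl⟩⟩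

/-- The last reducer runs only if some coreset point reaches it; a nonempty part provides one. -/
theorem IsValid.keys_mapped₃ (h : a.IsValid) : keys a.mapped₃ = {0} := by
  ext i
  simp only [keys, mapped₃, Multiset.mem_toFinset, Multiset.mem_map, Multiset.mem_bind,
    Multiset.mem_range, Finset.mem_singleton]
  constructor
  · rintro ⟨_, ⟨_, _, q, _, rfl⟩, rfl⟩
    rfl
  · rintro rfl
    obtain ⟨q, hq⟩ := h.support_nonempty h.pos
    exact ⟨_, ⟨0, h.pos, q, hq, rfl⟩, rfl⟩

theorem group_mapped₃ : group a.mapped₃ 0 = (Multiset.range a.L).bind fun i =>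
    (a.cover₂ i).val.support.val.map fun q => .weighted q ((a.cover₂ i).val q) := by
  rw [mapped₃, group_bind]
  refine Multiset.bind_congr fun i _ => ?_
  refine (group_map _ (fun _ => 0) (fun q => Value.weighted q ((a.cover₂ i).val q)) 0).trans ?_
  simp

theorem weightedSet_group : weightedSet (group a.mapped₃ 0) = a.coreset := by
  rw [group_mapped₃, weightedSet_bind]
  simp only [weightedSet_map_weighted]
  rfl

theorem reduce_solveRound :
    (solveRound seqW k z).reduce 0 (group a.mapped₃ 0) =
      { val := (seqW a.coreset k z).val.val.map fun s => (0, .center s)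
        work := 2 * a.coreset.support.card + (seqW a.coreset k z).work +
          (seqW a.coreset k z).val.card + 8 } := by
  simp only [solveRound, weightedSet_group]

theorem IsValid.exec_solveRound (h : a.IsValid) :
    (solveRound seqW k z).exec a.pairs₂ =
      (seqW a.coreset k z).val.val.map fun s => (0, .center s) := by
  rw [Round.exec, mapped_pairs₂, h.keys_mapped₃, Finset.singleton_val, Multiset.singleton_bind,
    reduce_solveRound]

/-- The output of the three rounds. -/
theorem IsValid.solution_eq (h : a.IsValid) :
    solution [a.round₁, a.round₂, solveRound seqW k z] a.P = (seqW a.coreset k z).val := by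
  rw [solution, run, run, run, run, h.exec_round₁, h.exec_round₂, h.exec_solveRound,
    Multiset.map_map]
  exact centers_map_center _

/-- Bounds for the quantities that determine the local memory. -/
structure IsBounded (a : Setup M) (S : Metered (Finset M)) (N B : ℕ) : Prop where
  piece_le : ∀ i < a.L, (a.Pi i).card ≤ N
  L_le : a.L ≤ N
  L_mul_le : ∀ i < a.L, a.L * (a.C i).card ≤ N
  sum_C_le : ∑ i ∈ Finset.range a.L, (a.C i).card ≤ N
  sum_T_le : ∑ i ∈ Finset.range a.L, (a.cover₂ i).val.support.card ≤ N
  centers₁_le : ∀ i < a.L, (a.centers₁ i).val.card ≤ N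
  work₁_le : ∀ i < a.L, (a.centers₁ i).work ≤ B * N
  center_le : S.val.card ≤ N
  work_le : S.work ≤ B * N

theorem card_union_le : a.union.card ≤ ∑ i ∈ Finset.range a.L, (a.C i).card := by
  rw [union, Finset.sup_eq_biUnion]
  exact Finset.card_biUnion_le

theorem card_coreset_le :
    a.coreset.support.card ≤ ∑ i ∈ Finset.range a.L, (a.cover₂ i).val.support.card := by
  refine (Finset.card_le_card ?_).trans Finset.card_biUnion_le
  exact Finsupp.support_finsetSum

/-- Every execution stores a bounded number of collections of at most about `N` words, besides
sequential work of at most `B * N`. The constant 50 is generous. -/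
theorem IsValid.localMemory_le (h : a.IsValid) {N B : ℕ}
    (hN : a.IsBounded (seqW a.coreset k z) N B) (hN1 : 1 ≤ N) :
    localMemory Value.words [a.round₁, a.round₂, solveRound seqW k z] (inputPairs a.P) ≤
      (B + 50) * N := by
  have hexp : (B + 50) * N = B * N + 50 * N := add_mul _ _ _
  rw [hexp]
  simp only [localMemory, h.exec_round₁, h.exec_round₂, Nat.max_zero]
  have hpoint : ∀ (s : Finset M) (κ : M → ℕ),
      pairWords Value.words (s.val.map fun p => (κ p, Value.point p)) = 2 * s.card := by
    intro s κ
    rw [pairWords_map]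
    simp [Value.words, mul_comm]
  have hCL : ∀ i < a.L, (a.C i).card ≤ N := fun i hi =>
    (Nat.le_mul_of_pos_left _ h.pos).trans (hN.L_mul_le i hi)
  refine max_le ?_ (max_le ?_ ?_)
  · refine Round.memory_le mapped_inputPairs ?_ ?_
    · intro b hb
      obtain ⟨p, hp, rfl⟩ := Multiset.mem_map.1 hb
      change pairWords _ _ + pairWords Value.words {(a.part p, Value.point p)} + 1 ≤ _
      simp only [pairWords_singleton, Value.words]
      omega
    · intro i hi
      rw [keys_map, h.map_part, Finset.mem_range] at hi
      rw [group_map_part]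
      change a.round₁.reduceMemory _ i ((a.Pi i).val.map .point) ≤ _
      rw [Round.reduceMemory, reduce_round₁, Multiset.map_map]
      simp only [Function.comp_def, pairWords_add, hpoint _ fun _ => i, pairWords_singleton,
        triplet, Value.words]
      have h1 := hN.piece_le i hi
      have h2 := hCL i hi
      have h3 := hN.centers₁_le i hi
      have h4 := hN.work₁_le i hi
      have h5 := (coverWithBalls_spec a.sel₁ (a.centers₁ i).val (a.γ / √(2 * a.β))
        (a.radius₁ i) (a.Pi i)).2.2
      change (a.cover₁ i).work ≤ _ at h5
      omega
  · refine Round.memory_le mapped_pairs₁ ?_ ?_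
    · intro b hb
      rcases Multiset.mem_add.1 hb with hb | hb
      · obtain ⟨p, hp, rfl⟩ := Multiset.mem_map.1 hb
        change pairWords _ _ + pairWords Value.words {(a.part p, Value.point p)} + 1 ≤ _
        simp only [pairWords_singleton, Value.words]
        omega
      · obtain ⟨i, hi, rfl⟩ := Multiset.mem_map.1 hb
        rw [Multiset.mem_range] at hi
        change pairWords _ _ + pairWords Value.words
          ((Multiset.range a.L).map fun j => (j, a.triplet i)) + 1 ≤ _
        rw [pairWords_map _ _ (fun j => j) fun _ => a.triplet i]
        simp only [pairWords_singleton, triplet, Value.words, Multiset.map_const',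
          Multiset.sum_replicate, Multiset.card_range, smul_eq_mul]
        -- The second map function sends `L` copies of a triplet, so a single execution already
        -- needs `L` times the size of `C i`.
        have h1 := hN.L_mul_le i hi
        have h2 := hCL i hi
        have h3 := hN.L_le
        have : a.L * (1 + (2 + (a.C i).card)) = 3 * a.L + a.L * (a.C i).card := by ring
        omega
    · intro i hi
      rw [h.keys_mapped₂, Finset.mem_range] at hi
      rw [group_mapped₂ hi, Round.reduceMemory, h.reduce_round₂, Multiset.map_add,
        Multiset.map_map, Multiset.map_map]
      simp only [Function.comp_def, pairWords_add, hpoint _ fun _ => i,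
        pairWords_map _ _ fun _ => i]
      simp only [triplet, Value.words]
      have e1 : (Multiset.map (fun j => 1 + (2 + (a.C j).card)) (Multiset.range a.L)).sum =
          3 * a.L + ∑ j ∈ Finset.range a.L, (a.C j).card := by
        change ∑ j ∈ Finset.range a.L, (1 + (2 + (a.C j).card)) = _
        simp only [Finset.sum_add_distrib, Finset.sum_const, Finset.card_range, smul_eq_mul]
        ring
      rw [e1, Multiset.map_const', Multiset.sum_replicate, smul_eq_mul, Finset.card_val]
      have h1 := hN.piece_le i hi
      have h2 := hN.sum_C_le
      have h3 := hN.L_le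
      have h4 := (Finset.single_le_sum (f := fun i => (a.cover₂ i).val.support.card)
        (fun _ _ => Nat.zero_le _) (Finset.mem_range.2 hi)).trans hN.sum_T_le
      have h5 := (coverWithBalls_spec a.sel₂ a.union (a.γ / √(2 * a.β)) a.radius₂ (a.Pi i)).2.2
      change (a.cover₂ i).work ≤ _ at h5
      have h6 := card_union_le.trans h2
      omega
  · refine Round.memory_le (mapped_pairs₂ _ _ _) ?_ ?_
    · intro b hb
      obtain ⟨i, _, hb⟩ := Multiset.mem_bind.1 hb
      obtain ⟨q, _, rfl⟩ := Multiset.mem_map.1 hb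
      change pairWords _ _ + pairWords Value.words {(0, Value.weighted q _)} + 1 ≤ _
      simp only [pairWords_singleton, Value.words]
      omega
    · intro i hi
      rw [h.keys_mapped₃, Finset.mem_singleton] at hi
      subst hi
      rw [Round.reduceMemory, reduce_solveRound, group_mapped₃, Multiset.map_bind]
      have e1 : pairWords Value.words ((Multiset.range a.L).bind fun i =>
          ((a.cover₂ i).val.support.val.map fun q =>
            Value.weighted q ((a.cover₂ i).val q)).map fun b => (0, b)) =
          3 * ∑ i ∈ Finset.range a.L, (a.cover₂ i).val.support.card := by
        rw [pairWords, Multiset.map_bind, Multiset.sum_bind, Finset.mul_sum]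
        refine congrArg Multiset.sum (Multiset.map_congr rfl fun i _ => ?_)
        simp [Value.words, mul_comm]
      have e2 : pairWords Value.words
          ((seqW a.coreset k z).val.val.map fun s => (0, Value.center s)) =
          2 * (seqW a.coreset k z).val.card := by
        rw [pairWords_map _ _ fun _ => 0]
        simp [Value.words, mul_comm]
      simp only [e1, e2]
      have h1 := hN.sum_T_le
      have h2 := a.card_coreset_le.trans h1
      have h3 := hN.center_le
      have h4 := hN.work_le
      omega

end Setup
end Trace

/-! ### The quality of the coreset -/

section Quality

variable {M : Type*} [MetricSpace M]

theorem cost_le_of_subset {P X Y : Finset M} (hX : X.Nonempty) (hXY : X ⊆ Y) :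
    cost P Y ≤ cost P X :=
  Finset.sum_le_sum fun _ _ => pow_le_pow_left₀ Metric.infDist_nonneg
    (Metric.infDist_le_infDist_of_subset (by simpa using hXY) (by simpa using hX)) 2

theorem infDist_sq_le_cost {P X : Finset M} {p : M} (hp : p ∈ P) :
    Metric.infDist p (X : Set M) ^ 2 ≤ cost P X :=
  Finset.single_le_sum (f := fun p => Metric.infDist p (X : Set M) ^ 2)
    (fun _ _ => sq_nonneg _) hp

/-- The square of a maximum is at most the sum of the squares. Since R² will be an average cost, |Q|
R² is again a cost. -/
theorem moveCost_le {Q X : Finset M} {δ R : ℝ} {π : M → M}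
    (h : ∀ p ∈ Q, dist p (π p) ≤ δ * max R (Metric.infDist p (X : Set M))) :
    moveCost Q π ≤ δ ^ 2 * (Q.card * R ^ 2 + cost Q X) := by
  have : (Q.card : ℝ) * R ^ 2 + cost Q X =
      ∑ p ∈ Q, (R ^ 2 + Metric.infDist p (X : Set M) ^ 2) := by
    rw [Finset.sum_add_distrib, Finset.sum_const, nsmul_eq_mul, cost]
  rw [this, Finset.mul_sum]
  refine Finset.sum_le_sum fun p hp => ?_
  refine (pow_le_pow_left₀ dist_nonneg (h p hp) 2).trans ?_
  rw [mul_pow]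
  refine mul_le_mul_of_nonneg_left ?_ (sq_nonneg _)
  rcases max_choice R (Metric.infDist p (X : Set M)) with h | h <;> rw [h] <;>
    linarith [sq_nonneg R, sq_nonneg (Metric.infDist p (X : Set M))]

theorem sqrt_le_mul_sqrt {x y c : ℝ} (hc : 0 ≤ c) (h : x ≤ c ^ 2 * y) : √x ≤ c * √y := by
  calc √x ≤ √(c ^ 2 * y) := Real.sqrt_le_sqrt h
    _ = c * √y := by rw [Real.sqrt_mul (sq_nonneg c), Real.sqrt_sq hc]

theorem dist_le_of_eq_or {p q : M} {δ R x : ℝ} (hδ : 0 ≤ δ) (hR : 0 ≤ R)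
    (h : p = q ∨ dist p q ≤ δ * max R x) : dist p q ≤ δ * max R x := by
  rcases h with rfl | h
  · rw [dist_self]
    exact mul_nonneg hδ (le_max_of_le_left hR)
  · exact h

namespace Setup

variable {a : Setup M} {A : ℕ}

/-- The precision of `CoverWithBalls`. -/
def δ (a : Setup M) : ℝ := a.γ / √(2 * a.β)

/-- The sum of the costs of the local solutions. -/
def localCost (a : Setup M) : ℝ :=
  ∑ i ∈ Finset.range a.L, cost (a.Pi i) (a.centers₁ i).val

/-- The requirements on the parameters and on the k-means algorithm. -/
structure IsAdmissible (a : Setup M) (A : ℕ) : Prop extends a.IsValid where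
  one_le_β : 1 ≤ a.β
  γ_pos : 0 < a.γ
  γ_le : a.γ ≤ 1 / 8
  approx : a.seqK.IsApprox a.P (a.k + a.z) A a.β

theorem IsAdmissible.β_pos (h : a.IsAdmissible A) : 0 < a.β := one_pos.trans_le h.one_le_β

theorem IsAdmissible.δ_pos (h : a.IsAdmissible A) : 0 < a.δ :=
  div_pos h.γ_pos (Real.sqrt_pos.2 (by linarith [h.β_pos]))

theorem IsAdmissible.δ_sq (h : a.IsAdmissible A) : a.δ ^ 2 = a.γ ^ 2 / (2 * a.β) := by
  rw [δ, div_pow, Real.sq_sqrt (by linarith [h.β_pos])]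

theorem IsAdmissible.γ_sq_le (h : a.IsAdmissible A) : a.γ ^ 2 / a.β ≤ 1 / 64 := by
  rw [div_le_iff₀ h.β_pos]
  nlinarith [h.one_le_β, h.γ_pos, h.γ_le]

theorem IsAdmissible.δ_le (h : a.IsAdmissible A) : a.δ ≤ 1 := by
  refine (sq_le_one_iff₀ h.δ_pos.le).1 ?_
  have h1 := h.γ_sq_le
  rw [h.δ_sq, mul_comm, ← div_div]
  linarith

theorem localCost_nonneg : 0 ≤ a.localCost := Finset.sum_nonneg fun _ _ => cost_nonneg _ _

theorem IsAdmissible.approx_Pi (h : a.IsAdmissible A) {i : ℕ} (hi : i < a.L) :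
    IsSolution (a.k + a.z) (a.Pi i) (a.centers₁ i).val ∧
    cost (a.Pi i) (a.centers₁ i).val ≤ a.β * opt (a.k + a.z) (a.Pi i) ∧
    (a.centers₁ i).work ≤ A * (a.Pi i).card :=
  h.approx _ (Pi_subset i) (h.nonempty i hi)

theorem IsAdmissible.card_mul_radius₁_sq (h : a.IsAdmissible A) {i : ℕ} (hi : i < a.L) :
    ((a.Pi i).card : ℝ) * a.radius₁ i ^ 2 = cost (a.Pi i) (a.centers₁ i).val := by
  have : (0 : ℝ) < (a.Pi i).card := by exact_mod_cast (h.nonempty i hi).card_pos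
  rw [radius₁, Real.sq_sqrt (div_nonneg (cost_nonneg _ _) this.le)]
  field_simp

theorem IsAdmissible.card_pos (h : a.IsAdmissible A) : 0 < a.P.card :=
  (h.nonempty 0 h.pos).card_pos.trans_le (Finset.card_le_card (Pi_subset 0))

theorem IsAdmissible.card_mul_radius₂_sq (h : a.IsAdmissible A) :
    (a.P.card : ℝ) * a.radius₂ ^ 2 = a.localCost := by
  have hP : (0 : ℝ) < a.P.card := by exact_mod_cast h.card_pos
  have : ∑ i ∈ Finset.range a.L, ((a.Pi i).card : ℝ) * a.radius₁ i ^ 2 = a.localCost :=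
    Finset.sum_congr rfl fun i hi => h.card_mul_radius₁_sq (Finset.mem_range.1 hi)
  rw [radius₂, this, Real.sq_sqrt (div_nonneg localCost_nonneg hP.le)]
  field_simp

/-- `X` need not lie in the parts; restricting its centers to a part costs the factor 4, and the
approximation the factor `β`. -/
theorem IsAdmissible.localCost_le (h : a.IsAdmissible A) {X : Finset M} (hX : X.Nonempty)
    (hXk : X.card ≤ a.k + a.z) : a.localCost ≤ 4 * a.β * cost a.P X := by
  have h1 : cost a.P X = ∑ i ∈ Finset.range a.L, cost (a.Pi i) X :=
    (h.sum_Pi fun p => Metric.infDist p (X : Set M) ^ 2).symm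
  rw [h1, Finset.mul_sum]
  refine Finset.sum_le_sum fun i hi => ?_
  rw [Finset.mem_range] at hi
  refine (h.approx_Pi hi).2.1.trans ?_
  have := mul_le_mul_of_nonneg_left (opt_le_four_mul_cost (h.nonempty i hi) hX hXk) h.β_pos.le
  linarith

theorem IsAdmissible.C_nonempty (h : a.IsAdmissible A) {i : ℕ} (hi : i < a.L) :
    (a.C i).Nonempty := by
  obtain ⟨⟨π, hπ, -⟩, -⟩ :=
    coverWithBalls_spec a.sel₁ (a.centers₁ i).val (a.γ / √(2 * a.β)) (a.radius₁ i) (a.Pi i)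
  obtain ⟨p, hp⟩ := h.nonempty i hi
  exact ⟨π p, hπ.mem_support.2 ⟨p, hp, rfl⟩⟩

theorem C_subset_Pi (i : ℕ) : a.C i ⊆ a.Pi i := by
  obtain ⟨⟨π, hπ, hπP⟩, -⟩ :=
    coverWithBalls_spec a.sel₁ (a.centers₁ i).val (a.γ / √(2 * a.β)) (a.radius₁ i) (a.Pi i)
  intro q hq
  obtain ⟨p, hp, rfl⟩ := hπ.mem_support.1 hq
  exact (hπP p hp).1

theorem C_subset_union {i : ℕ} (hi : i < a.L) : a.C i ⊆ a.union :=
  Finset.le_sup (f := a.C) (Finset.mem_range.2 hi)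

theorem union_subset : a.union ⊆ a.P :=
  Finset.sup_le fun i _ => (C_subset_Pi i).trans (Pi_subset i)

/-- Both terms of the movement bound equal the cost of the local solution, and 2δ² = γ²/β. -/
theorem IsAdmissible.cost_C_le (h : a.IsAdmissible A) {i : ℕ} (hi : i < a.L) :
    cost (a.Pi i) (a.C i) ≤ a.γ ^ 2 / a.β * cost (a.Pi i) (a.centers₁ i).val := by
  obtain ⟨⟨π, hπ, hπP⟩, -⟩ :=
    coverWithBalls_spec a.sel₁ (a.centers₁ i).val a.δ (a.radius₁ i) (a.Pi i)
  have h1 := moveCost_le fun p hp =>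
    dist_le_of_eq_or h.δ_pos.le (radius₁_nonneg i) (hπP p hp).2
  rw [h.card_mul_radius₁_sq hi, h.δ_sq] at h1
  refine le_trans (Finset.sum_le_sum fun p hp => ?_) (h1.trans_eq ?_)
  · refine pow_le_pow_left₀ Metric.infDist_nonneg (Metric.infDist_le_dist_of_mem ?_) 2
    exact hπ.mem_support.2 ⟨p, hp, rfl⟩
  · have := h.β_pos
    field_simp
    ring

theorem IsAdmissible.cost_union_le (h : a.IsAdmissible A) :
    cost a.P a.union ≤ a.γ ^ 2 / a.β * a.localCost := by
  have h1 : cost a.P a.union = ∑ i ∈ Finset.range a.L, cost (a.Pi i) a.union :=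
    (h.sum_Pi fun p => Metric.infDist p (a.union : Set M) ^ 2).symm
  rw [h1, localCost, Finset.mul_sum]
  refine Finset.sum_le_sum fun i hi => ?_
  rw [Finset.mem_range] at hi
  exact (cost_le_of_subset (h.C_nonempty hi) (C_subset_union hi)).trans (h.cost_C_le hi)

/-- The proxy maps of the parts are glued along the partition, and their fiber counts add up. -/
theorem IsAdmissible.exists_proxy (h : a.IsAdmissible A) :
    ∃ π : M → M, CountsFibers a.P π a.coreset ∧ (∀ p ∈ a.P, π p ∈ a.P) ∧
      ∀ p ∈ a.P, dist p (π p) ≤ a.δ * max a.radius₂ (Metric.infDist p (a.union : Set M)) := by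
  have := fun i => (coverWithBalls_spec a.sel₂ a.union a.δ a.radius₂ (a.Pi i)).1
  choose π hπ hπP using this
  refine ⟨fun p => π (a.part p) p, fun q => ?_, fun p hp => ?_, fun p hp => ?_⟩
  · rw [coreset, Finsupp.finsetSum_apply, Finset.card_filter, ← h.sum_Pi]
    refine Finset.sum_congr rfl fun i _ => ?_
    refine (hπ i q).trans ?_
    rw [Finset.card_filter]
    exact Finset.sum_congr rfl fun p hp => by simp only [(mem_Pi.1 hp).2]
  · exact Pi_subset _ (hπP _ p (mem_Pi.2 ⟨hp, rfl⟩)).1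
  · exact dist_le_of_eq_or h.δ_pos.le radius₂_nonneg
      (hπP _ p (mem_Pi.2 ⟨hp, rfl⟩)).2

/-- The sum of the local costs plus the much smaller cost of the union of the C_i is at most 8β
cost(P, X); multiplying by δ² = γ²/(2β) gives 4γ². -/
theorem IsAdmissible.moveCost_le (h : a.IsAdmissible A) {π : M → M}
    (hπ : ∀ p ∈ a.P, dist p (π p) ≤ a.δ * max a.radius₂ (Metric.infDist p (a.union : Set M)))
    {X : Finset M} (hX : X.Nonempty) (hXk : X.card ≤ a.k + a.z) :
    moveCost a.P π ≤ (2 * a.γ) ^ 2 * cost a.P X := by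
  have h1 := KMeansOutliers.moveCost_le hπ
  rw [h.card_mul_radius₂_sq, h.δ_sq] at h1
  have h2 := h.cost_union_le
  have h3 := mul_le_mul_of_nonneg_right h.γ_sq_le a.localCost_nonneg
  have h4 := h.localCost_le hX hXk
  have hβ := h.β_pos
  have h5 : a.localCost + cost a.P a.union ≤ 8 * a.β * cost a.P X := by
    linarith [a.localCost_nonneg]
  calc moveCost a.P π ≤ a.γ ^ 2 / (2 * a.β) * (8 * a.β * cost a.P X) :=
        h1.trans (mul_le_mul_of_nonneg_left h5 (by positivity))
    _ = _ := by
        field_simp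
        ring

/-- This is what the second round is for. A center may lie in another part than the points it
serves; with one radius R and one reference set U for all parts, its movement is at most δ(R + d(p,
U) + d(p, S)) for each such point p. The three terms contribute 3/2, 1/2 and 1 times γ√O. -/
theorem IsAdmissible.sqrt_center_move_le (h : a.IsAdmissible A) {π σ : M → M}
    (hπ : ∀ p ∈ a.P, dist p (π p) ≤ a.δ * max a.radius₂ (Metric.infDist p (a.union : Set M)))
    {S Z : Finset M} (hS : S ⊆ a.P) (hSne : S.Nonempty) (hcard : S.card + Z.card ≤ a.k + a.z)
    (hσ : ∀ p, σ p ∈ S ∧ Metric.infDist p (S : Set M) = dist p (σ p)) :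
    √(∑ p ∈ a.P \ Z, dist (σ p) (π (σ p)) ^ 2) ≤ 3 * a.γ * √(cost (a.P \ Z) S) := by
  set O := cost (a.P \ Z) S with hO
  have hO0 : 0 ≤ O := cost_nonneg _ _
  have hδ := h.δ_pos
  have hγ := h.γ_pos
  have hβ := h.β_pos
  have hW : a.localCost ≤ 4 * a.β * O := by
    refine (h.localCost_le (X := S ∪ Z) (hSne.mono Finset.subset_union_left)
      ((Finset.card_union_le _ _).trans hcard)).trans ?_
    gcongr
    exact KMeansOutliers.cost_union_le hSne
  have hW0 := a.localCost_nonneg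
  -- Used for the terms R and d(p, U), which are under control on all of `P`; the term d(p, S) must
  -- stay on `P \ Z`, as outliers may be far from `S`.
  have hsub : ∀ f : M → ℝ, ∑ p ∈ a.P \ Z, f p ^ 2 ≤ ∑ p ∈ a.P, f p ^ 2 := fun f =>
    Finset.sum_le_sum_of_subset_of_nonneg Finset.sdiff_subset fun _ _ _ => sq_nonneg _
  have e1 : √(∑ p ∈ a.P \ Z, (a.δ * a.radius₂) ^ 2) ≤ 3 / 2 * a.γ * √O := by
    refine sqrt_le_mul_sqrt (by positivity) ((hsub fun _ => a.δ * a.radius₂).trans ?_)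
    rw [Finset.sum_const, nsmul_eq_mul, mul_pow, mul_left_comm, h.card_mul_radius₂_sq, h.δ_sq]
    calc a.γ ^ 2 / (2 * a.β) * a.localCost ≤ a.γ ^ 2 / (2 * a.β) * (4 * a.β * O) := by gcongr
      _ = 2 * a.γ ^ 2 * O := by
        field_simp
        ring
      _ ≤ _ := by nlinarith [mul_nonneg (sq_nonneg a.γ) hO0]
  have e2 : √(∑ p ∈ a.P \ Z, (a.δ * Metric.infDist p (a.union : Set M)) ^ 2) ≤
      1 / 2 * a.γ * √O := by
    refine sqrt_le_mul_sqrt (by positivity) ((hsub _).trans ?_)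
    simp only [mul_pow]
    rw [← Finset.mul_sum, h.δ_sq]
    calc a.γ ^ 2 / (2 * a.β) * cost a.P a.union
        ≤ a.γ ^ 2 / (2 * a.β) * (1 / 64 * (4 * a.β * O)) := by
          gcongr
          refine h.cost_union_le.trans ?_
          exact mul_le_mul h.γ_sq_le hW hW0 (by norm_num)
      _ = 1 / 32 * a.γ ^ 2 * O := by
        field_simp
        ring
      _ ≤ _ := by nlinarith [mul_nonneg (sq_nonneg a.γ) hO0]
  have e3 : √(∑ p ∈ a.P \ Z, (a.δ * Metric.infDist p (S : Set M)) ^ 2) ≤ a.γ * √O := by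
    refine sqrt_le_mul_sqrt hγ.le ?_
    simp only [mul_pow]
    rw [← Finset.mul_sum, h.δ_sq]
    refine mul_le_mul_of_nonneg_right ?_ hO0
    rw [div_le_iff₀ (by positivity)]
    nlinarith [sq_nonneg a.γ, h.one_le_β]
  have hU := fun p => Metric.infDist_nonneg (x := p) (s := (a.union : Set M))
  have hSn := fun p => Metric.infDist_nonneg (x := p) (s := (S : Set M))
  have hR := a.radius₂_nonneg
  calc √(∑ p ∈ a.P \ Z, dist (σ p) (π (σ p)) ^ 2)
      ≤ √(∑ p ∈ a.P \ Z, (a.δ * a.radius₂ + a.δ * Metric.infDist p (a.union : Set M)) ^ 2) +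
          √(∑ p ∈ a.P \ Z, (a.δ * Metric.infDist p (S : Set M)) ^ 2) := by
        refine sqrt_sum_sq_le_add _ _ _ _ (fun _ _ => dist_nonneg) fun p _ => ?_
        refine (hπ _ (hS (hσ p).1)).trans ?_
        rw [← mul_add, ← mul_add]
        refine mul_le_mul_of_nonneg_left (max_le ?_ ?_) hδ.le
        · linarith [hU p, hSn p]
        · have := Metric.infDist_le_infDist_add_dist (s := (a.union : Set M)) (x := σ p) (y := p)
          rw [dist_comm, ← (hσ p).2] at this
          linarith
    _ ≤ √(∑ p ∈ a.P \ Z, (a.δ * a.radius₂) ^ 2) +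
          √(∑ p ∈ a.P \ Z, (a.δ * Metric.infDist p (a.union : Set M)) ^ 2) +
          √(∑ p ∈ a.P \ Z, (a.δ * Metric.infDist p (S : Set M)) ^ 2) := by
        gcongr
        refine sqrt_sum_sq_le_add _ _ _ _ (fun p _ => ?_) fun _ _ => le_rfl
        have := hU p
        positivity
    _ ≤ 3 * a.γ * √O := by linarith

/-- A bicriteria solution for the coreset is one for the whole point set. -/
theorem IsAdmissible.cost_le (h : a.IsAdmissible A) {k z : ℕ} {α : ℝ} (hα : 0 ≤ α)
    (hk1 : 1 ≤ k) (hk : k ≤ a.k) (hz : z ≤ a.z) {S Z : Finset M} (hSne : S.Nonempty)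
    (hSk : S.card ≤ a.k) (hZ : IsOut a.z a.P S Z) {v : M →₀ ℕ}
    (hv : IsTrimmed a.z a.coreset S v) (hcost : wcost v S ≤ α * woptOut k z a.coreset) :
    cost (a.P \ Z) S ≤ (α + 100 * α * a.γ) * optOut k z a.P := by
  obtain ⟨π, hπ, hπP, hπd⟩ := h.exists_proxy
  obtain ⟨S', Z', hS', hZ', hopt⟩ :=
    exists_optOut_eq z hk1 (Finset.card_pos.1 h.card_pos)
  have hZc : Z.card ≤ a.z := hZ.2.1.trans_le (min_le_left _ _)
  have hZc' : Z'.card ≤ z := hZ'.2.1.trans_le (min_le_left _ _)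
  choose σ hσ using fun p => exists_infDist_eq hS'.2.1 p
  rw [hopt]
  set O := cost (a.P \ Z') S'
  set V := cost (a.P \ Z) S
  have hO : 0 ≤ O := cost_nonneg _ _
  have hV : 0 ≤ V := cost_nonneg _ _
  have hγ := h.γ_pos
  have hγ8 := h.γ_le
  -- Round 1 allows as many centers as final centers and outliers together, so the outliers `Y` may
  -- join the centers `X`.
  have hmove : ∀ {X Y : Finset M}, X.Nonempty → X.card + Y.card ≤ a.k + a.z →
      √(moveCost a.P π) ≤ 2 * a.γ * √(cost (a.P \ Y) X) := fun {X Y} hX hc => by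
    refine sqrt_le_mul_sqrt (by positivity) ((h.moveCost_le hπd
      (hX.mono Finset.subset_union_left) ((Finset.card_union_le X Y).trans hc)).trans ?_)
    gcongr
    exact KMeansOutliers.cost_union_le hX
  -- The unknown cost `V` appears on both sides; it is absorbed on the left because 2γ < 1.
  have h1 : √V ≤ √(wcost v S) + 2 * a.γ * √V :=
    (sqrt_cost_sdiff_le hπ hZ hv).trans (add_le_add_right (hmove hSne (by omega)) _)
  have hc' : S'.card + Z'.card ≤ a.k + a.z := by
    have := hS'.2.2
    omega
  have h2 : √(woptOut k z a.coreset) ≤ √O + 3 * a.γ * √O + 2 * a.γ * √O :=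
    (sqrt_woptOut_le hπ hS' hZ'.1 hZc' hσ).trans (add_le_add (add_le_add_right
      (h.sqrt_center_move_le hπd hS'.1 hS'.2.1 hc' hσ) _) (hmove hS'.2.1 hc'))
  have hw0 : 0 ≤ woptOut k z a.coreset := by
    refine Real.sInf_nonneg ?_
    rintro _ ⟨S, v, _, _, rfl⟩
    exact wcost_nonneg _ _
  have h3 : woptOut k z a.coreset ≤ (1 + 5 * a.γ) ^ 2 * O := by
    calc woptOut k z a.coreset = √(woptOut k z a.coreset) ^ 2 := (Real.sq_sqrt hw0).symm
      _ ≤ ((1 + 5 * a.γ) * √O) ^ 2 := by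
        refine pow_le_pow_left₀ (Real.sqrt_nonneg _) ?_ 2
        linarith
      _ = _ := by rw [mul_pow, Real.sq_sqrt hO]
  have h4 : (1 - 2 * a.γ) ^ 2 * V ≤ wcost v S := by
    calc (1 - 2 * a.γ) ^ 2 * V = ((1 - 2 * a.γ) * √V) ^ 2 := by rw [mul_pow, Real.sq_sqrt hV]
      _ ≤ √(wcost v S) ^ 2 := by
        refine pow_le_pow_left₀ (mul_nonneg (by linarith) (Real.sqrt_nonneg _)) ?_ 2
        linarith
      _ = _ := Real.sq_sqrt (wcost_nonneg _ _)
  -- For γ ≤ 1/8 the quotient of the two squares is 1 + O(γ); 100 is far from optimal.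
  have h5 : (1 + 5 * a.γ) ^ 2 ≤ (1 - 2 * a.γ) ^ 2 * (1 + 100 * a.γ) := by
    nlinarith [mul_nonneg hγ.le (sub_nonneg.2 hγ8), pow_pos hγ 3]
  refine le_of_mul_le_mul_left ?_ (show 0 < (1 - 2 * a.γ) ^ 2 by
    have : 0 < 1 - 2 * a.γ := by linarith
    positivity)
  calc (1 - 2 * a.γ) ^ 2 * V ≤ α * ((1 + 5 * a.γ) ^ 2 * O) :=
        h4.trans (hcost.trans (mul_le_mul_of_nonneg_left h3 hα))
    _ ≤ α * ((1 - 2 * a.γ) ^ 2 * (1 + 100 * a.γ) * O) := by gcongr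
    _ = _ := by ring

end Setup
end Quality

/-! ### The local memory -/

section Memory

variable {M : Type*}

/-- Beside an empty part, all parts have at most one point, which leaves fewer than `L ≤ |P|` points
in all. -/
theorem IsEvenPartition.isValid {a : Setup M} (h : IsEvenPartition a.P a.L a.part)
    (hL : 1 ≤ a.L) (hLP : a.L ≤ a.P.card) : a.IsValid := by
  have hsum : ∑ i ∈ Finset.range a.L, (a.Pi i).card = a.P.card :=
    (Finset.card_eq_sum_card_fiberwise fun p hp => Finset.mem_coe.2
      (Finset.mem_range.2 (h.1 p hp))).symm
  refine ⟨h.1, fun i hi => ?_, hL⟩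
  rw [Finset.nonempty_iff_ne_empty]
  intro hne
  have h0 : (a.Pi i).card = 0 := by rw [hne, Finset.card_empty]
  have : ∑ j ∈ Finset.range a.L, (a.Pi j).card < ∑ j ∈ Finset.range a.L, 1 := by
    refine Finset.sum_lt_sum (fun j hj => ?_) ⟨i, Finset.mem_range.2 hi, by omega⟩
    have := h.2 j (Finset.mem_range.1 hj) i hi
    change (a.Pi j).card ≤ (a.Pi i).card + 1 at this
    omega
  rw [hsum, Finset.sum_const, Finset.card_range, smul_eq_mul, mul_one] at this
  omega

theorem Setup.IsValid.L_mul_card_Pi_le {a : Setup M} (h : a.IsValid) (he : IsEvenPartition a.P a.L a.part)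
    (hLP : a.L ≤ a.P.card) {i : ℕ} (hi : i < a.L) : a.L * (a.Pi i).card ≤ 2 * a.P.card := by
  calc a.L * (a.Pi i).card = ∑ _j ∈ Finset.range a.L, (a.Pi i).card := by simp
    _ ≤ ∑ j ∈ Finset.range a.L, ((a.Pi j).card + 1) :=
        Finset.sum_le_sum fun j hj => he.2 i hi j (Finset.mem_range.1 hj)
    _ = a.P.card + a.L := by rw [Finset.sum_add_distrib, h.sum_card]; simp
    _ ≤ _ := by omega

theorem Setup.eight_div_δ {a : Setup M} : 8 / a.δ = 8 * √(2 * a.β) / a.γ := by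
  rw [Setup.δ, div_div_eq_mul_div]

variable [MetricSpace M]

/-- The left side is the number of dyadic scales. It is at most m + 2 with m log 2 < log n, hence
below 3 log n / log 2 < 5 log n. -/
theorem clog_add_one_le {n : ℕ} (hn : 2 ≤ n) : (Nat.clog 2 n : ℝ) + 1 ≤ 5 * Real.log n := by
  have hn2 : (2 : ℝ) ≤ n := by exact_mod_cast hn
  have h1 := Real.log_two_gt_d9
  have h2 : Real.log 2 ≤ Real.log n := Real.log_le_log two_pos hn2
  have h3 : 2 ^ (Nat.clog 2 n).pred < n := Nat.pow_pred_clog_lt_self one_lt_two hn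
  have h4 : ((Nat.clog 2 n).pred : ℝ) * Real.log 2 < Real.log n := by
    rw [← Real.log_pow]
    exact Real.log_lt_log (by positivity) (by exact_mod_cast h3)
  have h5 : (Nat.clog 2 n : ℝ) ≤ (Nat.clog 2 n).pred + 1 := by
    exact_mod_cast Nat.le_succ_of_pred_le le_rfl
  nlinarith [(Nat.cast_nonneg (Nat.clog 2 n).pred : (0 : ℝ) ≤ _)]

/-- A single squared distance is at most the whole cost, so every distance is at most √n · R; this
limits the scales without any assumption on the spread of `P`. -/
theorem infDist_le_of_cost_le {P X : Finset M} {p : M} {n : ℕ} {R : ℝ} (hR : 0 ≤ R) (hp : p ∈ P)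
    (h : cost P X ≤ n * R ^ 2) : Metric.infDist p (X : Set M) ≤ 2 ^ Nat.clog 2 n * R := by
  refine le_of_sq_le_sq ?_ (by positivity)
  refine (infDist_sq_le_cost hp).trans (h.trans ?_)
  rw [mul_pow]
  refine mul_le_mul_of_nonneg_right ?_ (sq_nonneg R)
  have h1 : n ≤ 2 ^ Nat.clog 2 n := Nat.le_pow_clog one_lt_two n
  have h2 : 2 ^ Nat.clog 2 n ≤ (2 ^ Nat.clog 2 n) ^ 2 := Nat.le_self_pow two_ne_zero _
  exact_mod_cast h1.trans h2

namespace Setup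

variable {a : Setup M} {A : ℕ}

/-- The bound for the number of points that `CoverWithBalls` selects for each center. -/
def coverFactor (a : Setup M) : ℝ :=
  5 * Real.log a.P.card * (8 * √(2 * a.β) / a.γ) ^ doublingDim a.P

theorem IsAdmissible.one_le_coverFactor (h : a.IsAdmissible A) (hP : 2 ≤ a.P.card) :
    1 ≤ a.coverFactor := by
  have h1 := clog_add_one_le hP
  have h2 : (1 : ℝ) ≤ 5 * Real.log a.P.card :=
    le_trans (by linarith [(Nat.cast_nonneg (Nat.clog 2 a.P.card) : (0 : ℝ) ≤ _)]) h1
  refine one_le_mul_of_one_le_of_one_le h2 (Real.one_le_rpow ?_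
    (doublingDim_nonneg (Finset.card_pos.1 h.card_pos)))
  rw [← eight_div_δ, one_le_div h.δ_pos]
  linarith [h.δ_le]

theorem IsAdmissible.card_cover_le (h : a.IsAdmissible A) (hP : 2 ≤ a.P.card) {R : ℝ}
    (hR : 0 ≤ R) (sel : Selector M) {X Q : Finset M} (hX : X.Nonempty) (hXP : X ⊆ a.P)
    (hQP : Q ⊆ a.P) (hcost : cost Q X ≤ a.P.card * R ^ 2) :
    ((coverWithBalls sel X a.δ R Q).val.support.card : ℝ) ≤ X.card * a.coverFactor := by
  refine (card_coverWithBalls_le isDoubling_doublingDim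
    (doublingDim_nonneg (Finset.card_pos.1 h.card_pos)) h.δ_pos (by linarith [h.δ_le]) hR sel hX
    hXP hQP _ fun p hp => infDist_le_of_cost_le hR hp hcost).trans ?_
  rw [coverFactor, eight_div_δ]
  have : 0 < 8 * √(2 * a.β) / a.γ := by
    rw [← eight_div_δ]
    exact div_pos (by norm_num) h.δ_pos
  gcongr
  exact clog_add_one_le hP

theorem IsAdmissible.card_C_le (h : a.IsAdmissible A) (hP : 2 ≤ a.P.card) {i : ℕ}
    (hi : i < a.L) : ((a.C i).card : ℝ) ≤ (a.k + a.z : ℕ) * a.coverFactor := by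
  obtain ⟨⟨h1, h2, h3⟩, -, -⟩ := h.approx_Pi hi
  refine (h.card_cover_le hP (radius₁_nonneg i) a.sel₁ h2 (h1.trans (Pi_subset i))
    (Pi_subset i) ?_).trans ?_
  · rw [← h.card_mul_radius₁_sq hi]
    gcongr
    exact Pi_subset i
  · have := h.one_le_coverFactor hP
    gcongr

/-- The scale bound applies since |P| R² is the sum of the local costs, and the union of the C_i
costs at most 1/64 of it. -/
theorem IsAdmissible.card_T_le (h : a.IsAdmissible A) (hP : 2 ≤ a.P.card) (i : ℕ) :
    ((a.cover₂ i).val.support.card : ℝ) ≤ a.union.card * a.coverFactor := by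
  have hne := (h.C_nonempty h.pos).mono (C_subset_union h.pos)
  refine h.card_cover_le hP radius₂_nonneg a.sel₂ hne union_subset (Pi_subset i) ?_
  rw [h.card_mul_radius₂_sq]
  have h1 : cost (a.Pi i) a.union ≤ cost a.P a.union :=
    Finset.sum_le_sum_of_subset_of_nonneg (Pi_subset i) fun _ _ _ => sq_nonneg _
  have h2 := h.γ_sq_le
  have h3 := a.localCost_nonneg
  have h4 := h.cost_union_le
  nlinarith

theorem support_cover₂_subset (i : ℕ) : (a.cover₂ i).val.support ⊆ a.Pi i := by
  obtain ⟨⟨π, hπ, hπP⟩, -⟩ :=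
    coverWithBalls_spec a.sel₂ a.union (a.γ / √(2 * a.β)) a.radius₂ (a.Pi i)
  intro q hq
  obtain ⟨p, hp, rfl⟩ := hπ.mem_support.1 hq
  exact (hπP p hp).1

/-- The size bounds in terms of a real bound `G`. -/
theorem IsAdmissible.isBounded (h : a.IsAdmissible A) (he : IsEvenPartition a.P a.L a.part)
    (hLP : a.L ≤ a.P.card) (hP : 2 ≤ a.P.card) {S : Metered (Finset M)}
    (hS : S.val ⊆ a.coreset.support) (hSw : S.work ≤ A * a.coreset.support.card)
    {K B G : ℝ} (hK : ((a.k + a.z : ℕ) : ℝ) ≤ K) (hK1 : 1 ≤ K)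
    (hB : a.P.card ≤ a.L * B) (hL : (a.L : ℝ) = 1 ∧ a.P.card ≤ B ∨ a.L ^ 2 * K ≤ 4 * B)
    (hG : 4 * B * a.coverFactor ^ 2 ≤ G) : a.IsBounded S ⌊G⌋₊ A := by
  set H := a.coverFactor
  have hH : 1 ≤ H := h.one_le_coverFactor hP
  have hLpos : (1 : ℝ) ≤ a.L := by exact_mod_cast h.pos
  have hn0 : (0 : ℝ) ≤ a.P.card := Nat.cast_nonneg _
  have hB0 : 0 ≤ B := by
    by_contra! hB0
    nlinarith
  have hBG : 4 * B ≤ G :=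
    (le_mul_of_one_le_right (by linarith) (one_le_pow₀ hH)).trans hG
  have hBH : 4 * B * H ≤ G :=
    (mul_le_mul_of_nonneg_left (le_self_pow₀ hH two_ne_zero) (by linarith)).trans hG
  have hPi : ∀ i < a.L, ((a.Pi i).card : ℝ) ≤ 2 * B := fun i hi => by
    have : ((a.L * (a.Pi i).card : ℕ) : ℝ) ≤ (2 * a.P.card : ℕ) :=
      Nat.cast_le.2 (h.L_mul_card_Pi_le he hLP hi)
    push_cast at this
    refine le_of_mul_le_mul_left (a := (a.L : ℝ)) ?_ (by linarith)
    linarith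
  have hsumC : ∑ i ∈ Finset.range a.L, (a.C i).card ≤ a.P.card :=
    h.sum_card ▸ Finset.sum_le_sum fun i _ => Finset.card_le_card (C_subset_Pi i)
  have hsumT : ∑ i ∈ Finset.range a.L, (a.cover₂ i).val.support.card ≤ a.P.card :=
    h.sum_card ▸ Finset.sum_le_sum fun i _ => Finset.card_le_card (support_cover₂_subset i)
  have hC : ∀ i < a.L, ((a.C i).card : ℝ) ≤ K * H := fun i hi =>
    (h.card_C_le hP hi).trans (by gcongr)
  -- If `L = 1`, then `K` may exceed |P| and `L² K` need not be small; in that case the trivial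
  -- bounds by |P| ≤ B replace those through the doubling dimension.
  have hLG : (a.L : ℝ) ≤ G := by
    rcases hL with ⟨h1, h2⟩ | h1
    · have : (2 : ℝ) ≤ a.P.card := by exact_mod_cast hP
      linarith
    · nlinarith
  have hLC : ∀ i < a.L, (a.L : ℝ) * (a.C i).card ≤ G := fun i hi => by
    rcases hL with ⟨h1, h2⟩ | h1
    · have : ((a.C i).card : ℝ) ≤ (a.Pi i).card :=
        Nat.cast_le.2 (Finset.card_le_card (C_subset_Pi i))
      rw [h1, one_mul]
      linarith [hPi i hi]
    · calc (a.L : ℝ) * (a.C i).card ≤ a.L ^ 2 * (K * H) := by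
            gcongr
            · nlinarith
            · exact hC i hi
        _ = a.L ^ 2 * K * H := by ring
        _ ≤ 4 * B * H := by gcongr
        _ ≤ G := hBH
  have hunion : (∑ i ∈ Finset.range a.L, ((a.C i).card : ℝ)) ≤ a.L * (K * H) := by
    refine (Finset.sum_le_card_nsmul _ _ _ fun i hi => hC i (Finset.mem_range.1 hi)).trans_eq ?_
    rw [Finset.card_range, nsmul_eq_mul]
  have hsumC' : ((∑ i ∈ Finset.range a.L, (a.C i).card : ℕ) : ℝ) ≤ G := by
    rcases hL with ⟨h1, h2⟩ | h1
    · have : ((∑ i ∈ Finset.range a.L, (a.C i).card : ℕ) : ℝ) ≤ a.P.card := Nat.cast_le.2 hsumC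
      linarith
    · push_cast
      calc _ ≤ a.L * (K * H) := hunion
        _ ≤ a.L ^ 2 * (K * H) := by
            gcongr
            nlinarith
        _ = a.L ^ 2 * K * H := by ring
        _ ≤ 4 * B * H := by gcongr
        _ ≤ G := hBH
  have hsumT' : ((∑ i ∈ Finset.range a.L, (a.cover₂ i).val.support.card : ℕ) : ℝ) ≤ G := by
    rcases hL with ⟨h1, h2⟩ | h1
    · have : ((∑ i ∈ Finset.range a.L, (a.cover₂ i).val.support.card : ℕ) : ℝ) ≤ a.P.card :=
        Nat.cast_le.2 hsumT
      linarith
    · have hU : (a.union.card : ℝ) ≤ a.L * (K * H) :=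
        le_trans (by exact_mod_cast card_union_le) hunion
      push_cast
      -- Each of the `L` parts is covered relative to the whole union, whence the second factors `L`
      -- and `H`.
      calc _ ≤ a.L * (a.union.card * H) := by
            refine (Finset.sum_le_card_nsmul _ _ _ fun i _ => h.card_T_le hP i).trans_eq ?_
            rw [Finset.card_range, nsmul_eq_mul]
        _ ≤ a.L * (a.L * (K * H) * H) := by gcongr
        _ = a.L ^ 2 * K * H ^ 2 := by ring
        _ ≤ 4 * B * H ^ 2 := by gcongr
        _ ≤ G := hG
  have hPiN : ∀ i < a.L, (a.Pi i).card ≤ ⌊G⌋₊ := fun i hi =>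
    Nat.le_floor (by linarith [hPi i hi])
  have hT : a.coreset.support.card ≤ ⌊G⌋₊ :=
    card_coreset_le.trans (Nat.le_floor hsumT')
  exact
    { piece_le := hPiN
      L_le := Nat.le_floor hLG
      L_mul_le := fun i hi => Nat.le_floor (by exact_mod_cast hLC i hi)
      sum_C_le := Nat.le_floor hsumC'
      sum_T_le := Nat.le_floor hsumT'
      centers₁_le := fun i hi =>
        (Finset.card_le_card (h.approx_Pi hi).1.1).trans (hPiN i hi)
      work₁_le := fun i hi => (h.approx_Pi hi).2.2.trans (Nat.mul_le_mul_left A (hPiN i hi))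
      center_le := (Finset.card_le_card hS).trans hT
      work_le := hSw.trans (Nat.mul_le_mul_left A hT) }

end Setup

/-- The number of parts balances the sizes of the parts and of the union of the coresets. -/
theorem numParts_bounds {n K : ℝ} (hn : 0 < n) (hK : 0 < K) {L : ℕ}
    (hL : L = ⌈(n / K) ^ (1 / 3 : ℝ)⌉₊) :
    n ≤ L * (n ^ (2 / 3 : ℝ) * K ^ (1 / 3 : ℝ)) ∧
      ((L : ℝ) = 1 ∧ n ≤ n ^ (2 / 3 : ℝ) * K ^ (1 / 3 : ℝ) ∨
        (L : ℝ) ^ 2 * K ≤ 4 * (n ^ (2 / 3 : ℝ) * K ^ (1 / 3 : ℝ))) := by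
  set x := n ^ (1 / 3 : ℝ) with hx
  set y := K ^ (1 / 3 : ℝ) with hy
  have hx0 : 0 < x := Real.rpow_pos_of_pos hn _
  have hy0 : 0 < y := Real.rpow_pos_of_pos hK _
  have hx3 : x ^ 3 = n := by
    rw [hx, ← Real.rpow_natCast, ← Real.rpow_mul hn.le]
    norm_num
  have hy3 : y ^ 3 = K := by
    rw [hy, ← Real.rpow_natCast, ← Real.rpow_mul hK.le]
    norm_num
  have hx2 : n ^ (2 / 3 : ℝ) = x ^ 2 := by
    rw [hx, ← Real.rpow_natCast, ← Real.rpow_mul hn.le]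
    norm_num
  rw [Real.div_rpow hn.le hK.le] at hL
  change L = ⌈x / y⌉₊ at hL
  rw [hx2]
  have hu0 : 0 < x / y := div_pos hx0 hy0
  have hu : x / y ≤ L := hL ▸ Nat.le_ceil _
  have hL2 : (L : ℝ) < x / y + 1 := hL ▸ Nat.ceil_lt_add_one hu0.le
  have hn' : x / y * (x ^ 2 * y) = n := by
    rw [← hx3]
    field_simp
  have h1 : n ≤ L * (x ^ 2 * y) := by
    rw [← hn']
    gcongr
  refine ⟨h1, ?_⟩
  -- Rounding x/y up gives exactly 1 if x/y ≤ 1 and at most doubles it otherwise; the doubling is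
  -- the source of the factor 4.
  rcases le_or_gt (x / y) 1 with hle | hlt
  · have : L = 1 := hL.trans (le_antisymm (Nat.ceil_le.2 (by simpa using hle))
      (Nat.one_le_ceil_iff.2 hu0))
    subst this
    exact Or.inl ⟨Nat.cast_one, by simpa using h1⟩
  · refine Or.inr ?_
    calc (L : ℝ) ^ 2 * K ≤ (2 * (x / y)) ^ 2 * K := by
          gcongr
          linarith
      _ = 4 * (x ^ 2 * y) := by
          rw [← hy3]
          field_simp
          ring

end Memory

end KMeansOutliers

end

/-! ### The theorem -/

open KMeansOutliers in
theorem theorem2 :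
    ∃ c : ℝ, ∀ {M : Type*} [MetricSpace M] (P : Finset M) (k z L A : ℕ) (α β γ ρ τ : ℝ)
      (seqK : SeqKMeans M) (seqW : SeqWeightedKMeansOut M)
      (sel₁ sel₂ : Selector M) (part : M → ℕ),
      1 ≤ k → k < P.card →
      0 ≤ α → 1 ≤ β → 1 ≤ ρ → 1 ≤ τ →
      0 < γ → γ ≤ √(3 / 8) - 1 / 2 →
      1 ≤ L → L ≤ P.card → IsEvenPartition P L part →
      seqK.IsApprox P (⌊ρ * k⌋₊ + ⌊τ * z⌋₊) A β →
      seqW.IsApprox P k z A ρ τ α →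
      let alg := kMeansOutAlg seqK seqW sel₁ sel₂ part L k z ρ τ β γ
      let S := solution alg P
      alg.length = 3 ∧
      S ⊆ P ∧ S.Nonempty ∧ (S.card : ℝ) ≤ ρ * k ∧
      (∀ Z, IsOut ⌊τ * z⌋₊ P S Z →
        cost (P \ Z) S ≤ (α + c * α * γ) * optOut k z P) ∧
      (L = numParts P k z ρ τ →
        (localMemory Value.words alg (inputPairs P) : ℝ) ≤
          c * (1 + A) * ((P.card : ℝ) ^ (2 / 3 : ℝ) * (ρ * k + τ * z) ^ (1 / 3 : ℝ) *
            (8 * √(2 * β) / γ) ^ (2 * doublingDim P) * Real.log P.card ^ 2)) := by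
  -- The memory bound decides: 50 from `localMemory_le`, 4 from the rounding of `L`, and 5² from the
  -- two logarithmic factors. The approximation bound needs only 100.
  refine ⟨5000, ?_⟩
  intro M _ P k z L A α β γ ρ τ seqK seqW sel₁ sel₂ part hk1 hkP hα hβ hρ hτ hγ hγ8 hL hLP he
    hseqK hseqW alg S
  have hγ8' : γ ≤ 1 / 8 := by
    have : √(3 / 8) ≤ 5 / 8 := Real.sqrt_le_iff.2 ⟨by norm_num, by norm_num⟩
    linarith
  let a : Setup M := ⟨P, part, L, ⌊ρ * k⌋₊, ⌊τ * z⌋₊, β, γ, seqK, sel₁, sel₂⟩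
  have hkr : (1 : ℝ) ≤ k := by exact_mod_cast hk1
  have hzr : (0 : ℝ) ≤ z := Nat.cast_nonneg z
  have hρk : (k : ℝ) ≤ ρ * k := le_mul_of_one_le_left (by linarith) hρ
  have hτz : (z : ℝ) ≤ τ * z := le_mul_of_one_le_left hzr hτ
  have hvalid : a.IsValid := IsEvenPartition.isValid (a := a) he hL hLP
  have h : a.IsAdmissible A := ⟨hvalid, hβ, hγ, hγ8', hseqK⟩
  obtain ⟨π, hπ, hπP, -⟩ := h.exists_proxy
  have hTP : a.coreset.support ⊆ P := fun q hq => by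
    obtain ⟨p, hp, rfl⟩ := hπ.mem_support.1 hq
    exact hπP p hp
  obtain ⟨⟨hST, hSne, hSk⟩, ⟨v, hv, hcost⟩, hwork⟩ := hseqW a.coreset hTP hπ.weight_eq
  have hS : S = (seqW a.coreset k z).val := hvalid.solution_eq seqW k z
  rw [hS]
  refine ⟨rfl, hST.trans hTP, hSne, ?_, fun Z hZ => ?_, fun hLn => ?_⟩
  · exact (Nat.cast_le.2 hSk).trans (Nat.floor_le (by linarith))
  · refine (h.cost_le hα hk1 (Nat.le_floor hρk) (Nat.le_floor hτz) hSne hSk hZ hv hcost).trans ?_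
    have h0 : 0 ≤ optOut k z P := by
      refine Real.sInf_nonneg ?_
      rintro _ ⟨S, Z, _, _, rfl⟩
      exact cost_nonneg _ _
    change (α + 100 * α * γ) * optOut k z P ≤ _
    gcongr
    norm_num
  · have hP2 : 2 ≤ P.card := by omega
    have hn : (2 : ℝ) ≤ P.card := by exact_mod_cast hP2
    obtain ⟨h1, h2⟩ := numParts_bounds (n := P.card) (K := ρ * k + τ * z) (by linarith)
      (by linarith) hLn
    set B := (P.card : ℝ) ^ (2 / 3 : ℝ) * (ρ * k + τ * z) ^ (1 / 3 : ℝ)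
    have hF : (8 * √(2 * β) / γ) ^ (2 * doublingDim P) =
        ((8 * √(2 * β) / γ) ^ doublingDim P) ^ 2 := by
      rw [← Real.rpow_mul_natCast (by positivity), Nat.cast_ofNat, mul_comm 2 (doublingDim P)]
    have hK : ((a.k + a.z : ℕ) : ℝ) ≤ ρ * k + τ * z := by
      push_cast
      exact add_le_add (Nat.floor_le (by linarith)) (Nat.floor_le (by linarith))
    have hb := h.isBounded he hLP hP2 hST hwork hK (by linarith) h1 h2 le_rfl
    set G := 4 * B * a.coverFactor ^ 2 with hG
    have hG1 : 1 ≤ ⌊G⌋₊ := hL.trans hb.L_le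
    have hG0 : 0 ≤ G := zero_le_one.trans (Nat.one_le_floor_iff _ |>.1 hG1)
    have hmem := hvalid.localMemory_le seqW k z hb hG1
    change localMemory Value.words alg (inputPairs P) ≤ _ at hmem
    calc (localMemory Value.words alg (inputPairs P) : ℝ)
        ≤ ((A + 50) * ⌊G⌋₊ : ℕ) := Nat.cast_le.2 hmem
      _ = (A + 50) * (⌊G⌋₊ : ℝ) := by push_cast; rfl
      _ ≤ (50 * (1 + A)) * G := by
          gcongr
          · linarith [(Nat.cast_nonneg A : (0 : ℝ) ≤ A)]
          · exact Nat.floor_le hG0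
      _ = _ := by
          rw [hF, hG, Setup.coverFactor]
          ring
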